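/- Let $T>0$, let $(\Omega,\mathcal F,\mathbb F=(\mathcal F_t)_{0\le t\le T},P)$ be a filtered probability space carrying a standard ($\mathbb F$-)Brownian motion $W=(W_t)_{0\le t\le T}$, and let $\sigma>0$ and $x_0\in\mathbb R$ be constants. Let $b_0:\mathbb R\times\mathbb R\to\mathbb R$ be bounded and Lipschitz continuous in both variables, and for a probability measure $m$ on $\mathbb R$ put $b(x,m)=\int_{\mathbb R} b_0(x,y)\,m(dy)$. Let $\varphi:\mathbb R\to\mathbb R$ be a bounded measurable control function satisfying the rationality condition $(x-y)(\varphi(x)-\varphi(y))\le 0$ for all $x,y\in\mathbb R$. Then the McKean--Vlasov equation $$dX_t=\bigl(b(X_t,\mu_t)+\varphi(X_t)\bigr)\,dt+\sigma\,dW_t,\qquad X_0=x_0,\qquad \mu_t=\mathrm{Law}(X_t),\qquad 0\le t\le T,$$ has a unique solution $(X_t,\mu(\varphi)_t)_{0\le t\le T}$: there are an $\mathbb F$-adapted process $X$ with almost surely continuous paths and a flow $\mu(\varphi)=(\mu(\varphi)_t)_{0\le t\le T}$ of probability measures, $\mu(\varphi)_t$ being the law of $X_t$, such that almost surely $$X_t=x_0+\int_0^t\bigl(b(X_s,\mu(\varphi)_s)+\varphi(X_s)\bigr)\,ds+\sigma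 W_t\quad\text{for all }t\in[0,T],$$ and for any other such pair $(X',\mu')$ one has $\mu'_t=\mu(\varphi)_t$ for all $t\in[0,T]$ and, almost surely, $X'_t=X_t$ for all $t\in[0,T]$. Moreover, $\{\mu(\varphi)_t\}_{0\le t\le T}$ belongs to $\mathcal M_{[0,T]}$, the class of flows $(\mu_t)_{0\le t\le T}$ of time marginals of probability measures on $C([0,T];\mathbb R)$ for which there is $\beta\in(0,1]$ such that for every bounded Lipschitz function $\psi:\mathbb R\to\mathbb R$ there is a constant $c_1$ (which may depend on $\psi$) with $$\Bigl|\int_{\mathbb R}\psi\,d\mu_t-\int_{\mathbb R}\psi\,d\mu_{t'}\Bigr|\le c_1|t-t'|^{\beta}\qquad\text{for all }t,t'\in[0,T].$$ -/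

import Mathlib

open MeasureTheory ProbabilityTheory

namespace McKeanVlasov

/-- `W = (W_t)_{0 ≤ t ≤ T}` is a standard Brownian motion of the filtered probability space
`(Ω, 𝓕, P)`: adapted, started at `0`, almost surely continuous, and such that for `s ≤ t` the
increment `W_t - W_s` is independent of `𝓕_s` with law `N(0, t - s)`. -/
structure IsBrownianMotion {Ω : Type*} {mΩ : MeasurableSpace Ω} {T : ℝ}
    (𝓕 : Filtration (Set.Icc (0 : ℝ) T) mΩ) (P : Measure Ω)
    (W : Set.Icc (0 : ℝ) T → Ω → ℝ) : Prop where
  adapted : Adapted 𝓕 W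
  start_zero : ∀ t : Set.Icc (0 : ℝ) T, (t : ℝ) = 0 → ∀ᵐ ω ∂P, W t ω = 0
  continuous_paths : ∀ᵐ ω ∂P, Continuous fun t => W t ω
  indep_increments : ∀ s t : Set.Icc (0 : ℝ) T, s ≤ t →
    Indep (MeasurableSpace.comap (fun ω => W t ω - W s ω) inferInstance) (𝓕 s) P
  gaussian_increments : ∀ s t : Set.Icc (0 : ℝ) T, s ≤ t →
    P.map (fun ω => W t ω - W s ω) = gaussianReal 0 ((t : ℝ) - (s : ℝ)).toNNReal

/-- The mean-field drift `b(x, m) = ∫ b₀(x, y) m(dy)`. -/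
noncomputable def meanDrift (b₀ : ℝ → ℝ → ℝ) (x : ℝ) (m : ProbabilityMeasure ℝ) : ℝ :=
  ∫ y, b₀ x y ∂(m : Measure ℝ)

/-- `(X, μ)` solves, on `[0, T]`, the McKean–Vlasov equation
`dX_t = (b(X_t, μ_t) + φ(X_t)) dt + σ dW_t`, `X_0 = x₀`, `μ_t = Law(X_t)`:
`X` is an adapted process with almost surely continuous paths, `μ_t` is the law of `X_t`, and
almost surely `X_t = x₀ + ∫_0^t (b(X_s, μ_s) + φ(X_s)) ds + σ W_t` for all `t ∈ [0, T]`.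
Here `∫_0^t` is the integral over `Set.Iic t`, a subset of the interval `[0, T]` with its
Lebesgue measure, and, as `σ` is constant and `W_0 = 0`, `σ W_t` is the integral of `σ dW`. -/
structure IsSolution {Ω : Type*} {mΩ : MeasurableSpace Ω} {T : ℝ}
    (𝓕 : Filtration (Set.Icc (0 : ℝ) T) mΩ) (P : Measure Ω)
    (W : Set.Icc (0 : ℝ) T → Ω → ℝ) (b₀ : ℝ → ℝ → ℝ) (φ : ℝ → ℝ) (σ x₀ : ℝ)
    (X : Set.Icc (0 : ℝ) T → Ω → ℝ) (μ : Set.Icc (0 : ℝ) T → ProbabilityMeasure ℝ) : Prop where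
  adapted : Adapted 𝓕 X
  continuous_paths : ∀ᵐ ω ∂P, Continuous fun t => X t ω
  law : ∀ t, (μ t : Measure ℝ) = P.map (X t)
  equation : ∀ᵐ ω ∂P, ∀ t : Set.Icc (0 : ℝ) T,
    X t ω = x₀
      + (∫ s in Set.Iic t, (meanDrift b₀ (X s ω) (μ s) + φ (X s ω))
          ∂(Measure.comap (fun s : Set.Icc (0 : ℝ) T => (s : ℝ)) volume))
      + σ * W t ω

/-- The σ-algebra on the path space `C([0, T], ℝ)` generated by the coordinate maps; it is also
the Borel σ-algebra of the topology of uniform convergence. -/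
abbrev pathSigmaAlgebra (T : ℝ) : MeasurableSpace C(Set.Icc (0 : ℝ) T, ℝ) :=
  MeasurableSpace.comap (fun (w : C(Set.Icc (0 : ℝ) T, ℝ)) (t : Set.Icc (0 : ℝ) T) => w t)
    MeasurableSpace.pi

/-- The class `M_[0,T]` of flows of probability measures `(μ_t)_{0 ≤ t ≤ T}` on `ℝ`: the
time marginals of a probability measure on `C([0, T], ℝ)` for which there is an exponent
`β ∈ (0, 1]` such that, for every bounded Lipschitz `ψ`, the map `t ↦ ∫ ψ dμ_t` is `β`-Hölder
on `[0, T]` (with a constant that may depend on `ψ`). -/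
def flowClass (T : ℝ) : Set (Set.Icc (0 : ℝ) T → ProbabilityMeasure ℝ) :=
  {μ | (∃ Q : @Measure C(Set.Icc (0 : ℝ) T, ℝ) (pathSigmaAlgebra T),
          @IsProbabilityMeasure _ (pathSigmaAlgebra T) Q ∧
          ∀ t, @Measure.map _ _ (pathSigmaAlgebra T) _ (fun w => w t) Q = (μ t : Measure ℝ)) ∧
       ∃ β : ℝ, 0 < β ∧ β ≤ 1 ∧
        ∀ ψ : ℝ → ℝ, (∃ C, ∀ y, |ψ y| ≤ C) → (∃ K, LipschitzWith K ψ) →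
          ∃ c : ℝ, ∀ t t' : Set.Icc (0 : ℝ) T,
            |(∫ y, ψ y ∂(μ t : Measure ℝ)) - ∫ y, ψ y ∂(μ t' : Measure ℝ)|
              ≤ c * |(t : ℝ) - (t' : ℝ)| ^ β}

end McKeanVlasov

namespace McKeanVlasov

open Set Filter Topology

/-! The noise is additive, so it cancels in the difference of two solutions. That difference is an
absolutely continuous path bounded by `4 * C * T`, and its square is twice the integral of itself
times the difference of drifts (`sq_intervalIntegral_eq`). In this product the interaction is
Lipschitz in position and in law, while the control contributes a term of favourable sign. Grönwall,
for the mean square and then path by path, gives uniqueness even though `φ` may jump.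

For existence the same estimates are proved for processes whose drift is evaluated along a nearby
process `Y` (`IsApproxSolution`). Using the monotonicity of `φ` at `Y` instead of `X` costs only the
bound on `φ` times the distance between them (`IsCoefficientPair.mul_lawDrift_sub_le`). Euler
schemes are of this kind, with errors that vanish in mean and uniformly in time along each path, so
almost surely they are Cauchy at every time (`ae_exists_tendsto_eulerPath`).

In passing to the limit inside the drift only the discontinuities of `φ` matter. They are countably
many, since `φ` is antitone, and a Brownian path perturbed by a Lipschitz function spends zero time
at each level (`IsGaussianPath.ae_forall_volume_level_eq_zero`). Dominated convergence then yields
the equation. The drift being bounded, increments of the solution over a time `u` are of order `√u`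
in mean, hence the Hölder exponent `1 / 2`. -/

/-! ### Energy identity and Grönwall inequality -/

/-- Integration by parts of the primitive against itself. It is done for absolutely continuous
functions because the drift, and hence `γ`, need not be continuous; the primitive has derivative `γ`
only almost everywhere. -/
theorem sq_intervalIntegral_eq {γ : ℝ → ℝ} {a t : ℝ} (hγ : IntervalIntegrable γ volume a t) :
    (∫ s in a..t, γ s) ^ 2 = 2 * ∫ s in a..t, (∫ r in a..s, γ r) * γ s := by
  have hac := hγ.absolutelyContinuousOnInterval_intervalIntegral (c := a) (by simp)
  have h := hac.integral_mul_deriv_eq_deriv_mul hac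
  have hd : ∀ᵐ s, s ∈ uIoc a t → deriv (fun x => ∫ v in a..x, γ v) s = γ s := by
    filter_upwards [hγ.ae_hasDerivAt_integral] with s hs hst
    exact (hs (uIoc_subset_uIcc hst) a (by simp)).deriv
  have h1 : ∫ s in a..t, (∫ r in a..s, γ r) * deriv (fun x => ∫ v in a..x, γ v) s
      = ∫ s in a..t, (∫ r in a..s, γ r) * γ s := by
    apply intervalIntegral.integral_congr_ae
    filter_upwards [hd] with s hs hst
    rw [hs hst]
  have h2 : ∫ s in a..t, deriv (fun x => ∫ v in a..x, γ v) s * (∫ r in a..s, γ r)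
      = ∫ s in a..t, (∫ r in a..s, γ r) * γ s := by
    rw [← h1]
    simp only [mul_comm]
  rw [h1, h2] at h
  simp only [intervalIntegral.integral_same] at h
  linarith

theorem le_mul_exp_of_le_add_mul_integral {u : ℝ → ℝ} {A K T : ℝ} (hK : 0 ≤ K)
    (hu : ContinuousOn u (Icc 0 T))
    (h : ∀ t ∈ Icc 0 T, u t ≤ A + K * ∫ s in (0 : ℝ)..t, u s) :
    ∀ t ∈ Icc 0 T, u t ≤ A * Real.exp (K * t) := by
  intro t ht
  have hT : 0 ≤ T := ht.1.trans ht.2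
  -- Extending `u` by constants outside `[0, T]` makes the primitive differentiable at every real
  -- point, endpoints included.
  set w : ℝ → ℝ := fun s => u (projIcc 0 T hT s) with hw
  have hwc : Continuous w := hu.comp_continuous (by fun_prop) fun s => (projIcc 0 T hT s).2
  have hwu : ∀ s ∈ Icc 0 T, w s = u s := fun s hs => by simp [hw, projIcc_of_mem hT hs]
  have hint : ∀ s ∈ Icc 0 T, ∫ r in (0 : ℝ)..s, u r = ∫ r in (0 : ℝ)..s, w r := by
    intro s hs
    apply intervalIntegral.integral_congr
    intro r hr
    rw [uIcc_of_le hs.1] at hr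
    exact (hwu r ⟨hr.1, hr.2.trans hs.2⟩).symm
  have hv : ∀ s, HasDerivAt (fun s => ∫ r in (0 : ℝ)..s, w r) (w s) s := fun s =>
    intervalIntegral.integral_hasDerivAt_right (hwc.intervalIntegrable _ _)
      (hwc.stronglyMeasurableAtFilter _ _) hwc.continuousAt
  set v : ℝ → ℝ := fun s => (A + K * ∫ r in (0 : ℝ)..s, w r) * Real.exp (-(K * s)) with hvdef
  have hvd : ∀ s, HasDerivAt v
      (K * w s * Real.exp (-(K * s)) +
        (A + K * ∫ r in (0 : ℝ)..s, w r) * (Real.exp (-(K * s)) * (-(K * 1)))) s := fun s =>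
    (((hv s).const_mul K).const_add A).mul (((hasDerivAt_id s).const_mul K).neg.exp)
  have hanti : AntitoneOn v (Icc 0 T) := by
    apply antitoneOn_of_deriv_nonpos (convex_Icc 0 T)
    · exact fun s _ => (hvd s).continuousAt.continuousWithinAt
    · exact fun s _ => (hvd s).differentiableAt.differentiableWithinAt
    · intro s hs
      rw [interior_Icc] at hs
      rw [(hvd s).deriv]
      have h1 := h s (Ioo_subset_Icc_self hs)
      rw [← hwu s (Ioo_subset_Icc_self hs), hint s (Ioo_subset_Icc_self hs)] at h1
      have := mul_nonneg (mul_nonneg hK (Real.exp_pos (-(K * s))).le) (sub_nonneg.2 h1)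
      linarith
  have h0 := hanti (left_mem_Icc.2 hT) ht ht.1
  simp only [hvdef, intervalIntegral.integral_same, mul_zero, add_zero, Real.exp_zero,
    Real.exp_neg] at h0
  rw [← div_eq_mul_inv, div_le_iff₀ (Real.exp_pos _)] at h0
  have h1 := h t ht
  rw [hint t ht] at h1
  linarith

/-- Grönwall applied to the square of the primitive. The factors 2 come from the energy identity,
and `r` contributes `2 * r * T` over the whole interval. -/
theorem sq_integral_le_of_mul_le {γ : ℝ → ℝ} {T k r : ℝ} (hk : 0 ≤ k) (hr : 0 ≤ r)
    (hγ : IntervalIntegrable γ volume 0 T)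
    (h : ∀ s ∈ Icc 0 T, (∫ q in (0 : ℝ)..s, γ q) * γ s ≤ k * (∫ q in (0 : ℝ)..s, γ q) ^ 2 + r) :
    ∀ t ∈ Icc 0 T, (∫ q in (0 : ℝ)..t, γ q) ^ 2 ≤ 2 * r * T * Real.exp (2 * k * T) := by
  intro t ht
  have hT : 0 ≤ T := ht.1.trans ht.2
  have hsub : ∀ s ∈ Icc 0 T, uIcc 0 s ⊆ uIcc 0 T := fun s hs => by
    rw [uIcc_of_le hs.1, uIcc_of_le hT]; exact Icc_subset_Icc_right hs.2
  have hcont : ContinuousOn (fun s => ∫ q in (0 : ℝ)..s, γ q) (Icc 0 T) := by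
    have := (hγ.absolutelyContinuousOnInterval_intervalIntegral (c := 0) (by simp)).continuousOn
    rwa [uIcc_of_le hT] at this
  have hgr := le_mul_exp_of_le_add_mul_integral (u := fun s => (∫ q in (0 : ℝ)..s, γ q) ^ 2)
    (A := 2 * r * T) (K := 2 * k) (by positivity) (hcont.pow 2) ?_ t ht
  · refine hgr.trans ?_
    have : Real.exp (2 * k * t) ≤ Real.exp (2 * k * T) := by
      apply Real.exp_le_exp.2
      exact mul_le_mul_of_nonneg_left ht.2 (by positivity)
    exact mul_le_mul_of_nonneg_left this (by positivity)
  · intro s hs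
    have hc' : ContinuousOn (fun s => ∫ q in (0 : ℝ)..s, γ q) (uIcc 0 s) := by
      rw [uIcc_of_le hs.1]; exact hcont.mono (Icc_subset_Icc_right hs.2)
    rw [sq_intervalIntegral_eq (hγ.mono_set (hsub s hs))]
    have hi : ∫ q in (0 : ℝ)..s, (∫ p in (0 : ℝ)..q, γ p) * γ q
        ≤ ∫ q in (0 : ℝ)..s, (k * (∫ p in (0 : ℝ)..q, γ p) ^ 2 + r) := by
      apply intervalIntegral.integral_mono_on hs.1
      · exact (hγ.mono_set (hsub s hs)).continuousOn_mul hc'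
      · exact ((continuousOn_const.mul (hc'.pow 2)).add continuousOn_const).intervalIntegrable
      · exact fun q hq => h q ⟨hq.1, hq.2.trans hs.2⟩
    rw [intervalIntegral.integral_add, intervalIntegral.integral_const_mul,
      intervalIntegral.integral_const, smul_eq_mul, sub_zero] at hi
    · have : s * r ≤ T * r := mul_le_mul_of_nonneg_right hs.2 hr
      linarith
    · exact (continuousOn_const.mul (hc'.pow 2)).intervalIntegrable
    · simp


/-! ### One-sided estimates for the drift -/

/-- Standing assumptions on the coefficients, with explicit constants. -/
structure IsCoefficientPair (b₀ : ℝ → ℝ → ℝ) (φ : ℝ → ℝ) (C L : ℝ) : Prop where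
  bound_nonneg : 0 ≤ C
  lip_nonneg : 0 ≤ L
  abs_interaction_le : ∀ x y, |b₀ x y| ≤ C
  interaction_lipschitz : ∀ x y x' y', |b₀ x y - b₀ x' y'| ≤ L * (|x - x'| + |y - y'|)
  measurable_control : Measurable φ
  abs_control_le : ∀ x, |φ x| ≤ C
  control_rational : ∀ x y, (x - y) * (φ x - φ y) ≤ 0

/-- The drift `E[b₀(x, Y)] + φ(x)`, in which the measure argument is the law of `Y`. -/
noncomputable def lawDrift {Ω : Type*} {mΩ : MeasurableSpace Ω} (P : Measure Ω)
    (b₀ : ℝ → ℝ → ℝ) (φ : ℝ → ℝ) (Y : Ω → ℝ) (x : ℝ) : ℝ :=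
  (∫ ω, b₀ x (Y ω) ∂P) + φ x

namespace IsCoefficientPair

variable {b₀ : ℝ → ℝ → ℝ} {φ : ℝ → ℝ} {C L : ℝ}

theorem continuous_uncurry (h : IsCoefficientPair b₀ φ C L) :
    Continuous (Function.uncurry b₀) := by
  have : LipschitzWith (2 * L).toNNReal (Function.uncurry b₀) := by
    apply LipschitzWith.of_dist_le_mul
    rintro ⟨x, y⟩ ⟨x', y'⟩
    rw [Real.coe_toNNReal _ (mul_nonneg zero_le_two h.lip_nonneg)]
    refine (h.interaction_lipschitz x y x' y').trans ?_
    have h1 : |x - x'| ≤ dist (x, y) (x', y') := le_max_left _ _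
    have h2 : |y - y'| ≤ dist (x, y) (x', y') := le_max_right _ _
    have := mul_le_mul_of_nonneg_left (add_le_add h1 h2) h.lip_nonneg
    linarith
  exact this.continuous

/-- Besides the sign in the energy estimate, monotonicity guarantees that `φ` has at most countably
many discontinuities. -/
theorem antitone_control (h : IsCoefficientPair b₀ φ C L) : Antitone φ := by
  intro x y hxy
  rcases hxy.eq_or_lt with rfl | hlt
  · exact le_rfl
  · have := h.control_rational x y
    by_contra! hc
    nlinarith [mul_pos (sub_pos.2 hlt) (sub_pos.2 hc)]

variable {Ω : Type*} {mΩ : MeasurableSpace Ω} {P : Measure Ω} [IsProbabilityMeasure P]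

theorem integrable_interaction (h : IsCoefficientPair b₀ φ C L) {Y : Ω → ℝ} (hY : Measurable Y)
    (x : ℝ) : Integrable (fun ω => b₀ x (Y ω)) P := by
  refine Integrable.of_bound (C := C) ?_ (ae_of_all _ fun ω => h.abs_interaction_le _ _)
  have : Measurable fun ω => Function.uncurry b₀ (x, Y ω) :=
    h.continuous_uncurry.measurable.comp (measurable_const.prodMk hY)
  exact this.aestronglyMeasurable

theorem abs_integral_interaction_le (h : IsCoefficientPair b₀ φ C L) (Y : Ω → ℝ) (x : ℝ) :
    |∫ ω, b₀ x (Y ω) ∂P| ≤ C := by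
  have := norm_integral_le_of_norm_le_const (μ := P) (f := fun ω => b₀ x (Y ω)) (C := C)
    (ae_of_all _ fun ω => h.abs_interaction_le _ _)
  simpa using this

theorem abs_lawDrift_le (h : IsCoefficientPair b₀ φ C L) (Y : Ω → ℝ) (x : ℝ) :
    |lawDrift P b₀ φ Y x| ≤ 2 * C := by
  have h1 := h.abs_integral_interaction_le (P := P) Y x
  have h2 := h.abs_control_le x
  calc |lawDrift P b₀ φ Y x| ≤ |∫ ω, b₀ x (Y ω) ∂P| + |φ x| := abs_add_le _ _
    _ ≤ 2 * C := by linarith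

/-- The distance of the two laws is measured through the coupling given by `Y` and `Y'` on the same
space, so no optimal transport is needed. -/
theorem abs_integral_interaction_sub_le (h : IsCoefficientPair b₀ φ C L) {Y Y' : Ω → ℝ}
    (hY : Measurable Y) (hY' : Measurable Y') (hi : Integrable (fun ω => Y ω - Y' ω) P)
    (y y' : ℝ) :
    |(∫ ω, b₀ y (Y ω) ∂P) - ∫ ω, b₀ y' (Y' ω) ∂P|
      ≤ L * (|y - y'| + ∫ ω, |Y ω - Y' ω| ∂P) := by
  rw [← integral_sub (h.integrable_interaction hY y) (h.integrable_interaction hY' y')]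
  calc |∫ ω, (b₀ y (Y ω) - b₀ y' (Y' ω)) ∂P| ≤ ∫ ω, |b₀ y (Y ω) - b₀ y' (Y' ω)| ∂P :=
        abs_integral_le_integral_abs
    _ ≤ ∫ ω, L * (|y - y'| + |Y ω - Y' ω|) ∂P := by
        apply integral_mono
        · exact ((h.integrable_interaction hY y).sub (h.integrable_interaction hY' y')).abs
        · exact ((integrable_const _).add hi.abs).const_mul L
        · exact fun ω => h.interaction_lipschitz _ _ _ _
    _ = L * (|y - y'| + ∫ ω, |Y ω - Y' ω| ∂P) := by
        rw [integral_const_mul, integral_add (integrable_const _) hi.abs]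
        simp

/-- Split `x - x'` into `y - y'` and the error `(x - y) - (x' - y')`. Against `φ y - φ y'` the first
piece is nonpositive by rationality, and the second costs at most `2 * C` times the error.
Continuity of `φ` plays no role. -/
theorem mul_lawDrift_sub_le (h : IsCoefficientPair b₀ φ C L) {Y Y' : Ω → ℝ}
    (hY : Measurable Y) (hY' : Measurable Y') (hi : Integrable (fun ω => Y ω - Y' ω) P)
    (x x' y y' : ℝ) :
    (x - x') * (lawDrift P b₀ φ Y y - lawDrift P b₀ φ Y' y')
      ≤ 2 * C * (|x - y| + |x' - y'|)
        + |x - x'| * (L * (|y - y'| + ∫ ω, |Y ω - Y' ω| ∂P)) := by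
  have h1 : (x - x') * ((∫ ω, b₀ y (Y ω) ∂P) - ∫ ω, b₀ y' (Y' ω) ∂P)
      ≤ |x - x'| * (L * (|y - y'| + ∫ ω, |Y ω - Y' ω| ∂P)) := by
    refine (le_abs_self _).trans ?_
    rw [abs_mul]
    exact mul_le_mul_of_nonneg_left (h.abs_integral_interaction_sub_le hY hY' hi y y')
      (abs_nonneg _)
  have h2 : ((x - y) - (x' - y')) * (φ y - φ y') ≤ (|x - y| + |x' - y'|) * (2 * C) := by
    refine (le_abs_self _).trans ?_
    rw [abs_mul]
    refine mul_le_mul (abs_sub _ _) ?_ (abs_nonneg _) (by positivity)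
    have := h.abs_control_le y
    have := h.abs_control_le y'
    have := abs_sub (φ y) (φ y')
    linarith
  have h3 := h.control_rational y y'
  have h4 : (x - x') * (lawDrift P b₀ φ Y y - lawDrift P b₀ φ Y' y')
      = (x - x') * ((∫ ω, b₀ y (Y ω) ∂P) - ∫ ω, b₀ y' (Y' ω) ∂P)
        + ((x - y) - (x' - y')) * (φ y - φ y') + (y - y') * (φ y - φ y') := by
    simp only [lawDrift]; ring
  rw [h4]
  linarith

theorem measurable_lawDrift_uncurry (h : IsCoefficientPair b₀ φ C L) {Y : ℝ → Ω → ℝ}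
    (hY : Measurable (Function.uncurry Y)) :
    Measurable fun p : ℝ × Ω => lawDrift P b₀ φ (Y p.1) (Y p.1 p.2) := by
  have hm : Measurable fun q : (ℝ × Ω) × Ω => Function.uncurry b₀ (Y q.1.1 q.1.2, Y q.1.1 q.2) :=
    h.continuous_uncurry.measurable.comp ((hY.comp measurable_fst).prodMk
      (hY.comp ((measurable_fst.comp measurable_fst).prodMk measurable_snd)))
  have := StronglyMeasurable.integral_prod_right (ν := P)
    (f := fun (p : ℝ × Ω) (ω : Ω) => b₀ (Y p.1 p.2) (Y p.1 ω)) hm.stronglyMeasurable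
  exact this.measurable.add (h.measurable_control.comp hY)

theorem intervalIntegrable_lawDrift (h : IsCoefficientPair b₀ φ C L) {Y : ℝ → Ω → ℝ}
    (hY : Measurable (Function.uncurry Y)) (ω : Ω) (a b : ℝ) :
    IntervalIntegrable (fun s => lawDrift P b₀ φ (Y s) (Y s ω)) volume a b := by
  refine (intervalIntegrable_const (c := 2 * C)).mono_fun ?_ ?_
  · exact ((h.measurable_lawDrift_uncurry (P := P) hY).comp
      measurable_prodMk_right).aestronglyMeasurable
  · refine ae_of_all _ fun s => ?_
    simp only [Real.norm_eq_abs]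
    exact (h.abs_lawDrift_le _ _).trans (le_abs_self _)

end IsCoefficientPair

/-! ### Stability of approximate solutions -/

/-- `X` solves the McKean–Vlasov equation on `[0, T]` with the drift evaluated along a process `Y`
that is `ρ`-close to `X` in mean. -/
structure IsApproxSolution {Ω : Type*} {mΩ : MeasurableSpace Ω} (P : Measure Ω)
    (W : ℝ → Ω → ℝ) (b₀ : ℝ → ℝ → ℝ) (φ : ℝ → ℝ) (σ x₀ T ρ : ℝ) (X Y : ℝ → Ω → ℝ) : Prop where
  measurable_process : Measurable (Function.uncurry X)
  measurable_frozen : Measurable (Function.uncurry Y)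
  equation : ∀ᵐ ω ∂P, ∀ t ∈ Icc 0 T,
    X t ω = x₀ + (∫ s in (0 : ℝ)..t, lawDrift P b₀ φ (Y s) (Y s ω)) + σ * W t ω
  integrable_error : ∀ t ∈ Icc 0 T, Integrable (fun ω => X t ω - Y t ω) P
  integral_error_le : ∀ t ∈ Icc 0 T, ∫ ω, |X t ω - Y t ω| ∂P ≤ ρ

namespace IsApproxSolution

variable {Ω : Type*} {mΩ : MeasurableSpace Ω} {P : Measure Ω}
  {b₀ : ℝ → ℝ → ℝ} {φ : ℝ → ℝ} {C L : ℝ} {W : ℝ → Ω → ℝ} {σ x₀ T ρ ρ' : ℝ} {X Y X' Y' : ℝ → Ω → ℝ}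

theorem error_nonneg (hX : IsApproxSolution P W b₀ φ σ x₀ T ρ X Y) (hT : 0 ≤ T) : 0 ≤ ρ :=
  (integral_nonneg fun _ => abs_nonneg _).trans (hX.integral_error_le 0 ⟨le_rfl, hT⟩)

theorem measurable_sub_process (hX : IsApproxSolution P W b₀ φ σ x₀ T ρ X Y)
    (hX' : IsApproxSolution P W b₀ φ σ x₀ T ρ' X' Y') (t : ℝ) :
    Measurable fun ω => X t ω - X' t ω :=
  (hX.measurable_process.comp measurable_prodMk_left).sub
    (hX'.measurable_process.comp measurable_prodMk_left)

variable [IsProbabilityMeasure P]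

theorem sub_eq_integral (hX : IsApproxSolution P W b₀ φ σ x₀ T ρ X Y)
    (hX' : IsApproxSolution P W b₀ φ σ x₀ T ρ' X' Y') (hc : IsCoefficientPair b₀ φ C L) :
    ∀ᵐ ω ∂P, ∀ t ∈ Icc 0 T, X t ω - X' t ω = ∫ s in (0 : ℝ)..t,
      (lawDrift P b₀ φ (Y s) (Y s ω) - lawDrift P b₀ φ (Y' s) (Y' s ω)) := by
  filter_upwards [hX.equation, hX'.equation] with ω h h' t ht
  rw [h t ht, h' t ht, intervalIntegral.integral_sub
    (hc.intervalIntegrable_lawDrift hX.measurable_frozen ω 0 t)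
    (hc.intervalIntegrable_lawDrift hX'.measurable_frozen ω 0 t)]
  ring

theorem abs_integral_drift_sub_le (hc : IsCoefficientPair b₀ φ C L) (Y Y' : ℝ → Ω → ℝ) (ω : Ω)
    (s t : ℝ) :
    |∫ s in s..t, (lawDrift P b₀ φ (Y s) (Y s ω) - lawDrift P b₀ φ (Y' s) (Y' s ω))|
      ≤ 4 * C * |t - s| := by
  rw [← Real.norm_eq_abs]
  refine intervalIntegral.norm_integral_le_of_norm_le_const fun s _ => ?_
  have h1 := hc.abs_lawDrift_le (P := P) (Y s) (Y s ω)
  have h2 := hc.abs_lawDrift_le (P := P) (Y' s) (Y' s ω)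
  have := abs_sub (lawDrift P b₀ φ (Y s) (Y s ω)) (lawDrift P b₀ φ (Y' s) (Y' s ω))
  rw [Real.norm_eq_abs]
  linarith

/-- Once the noise has cancelled, only a difference of two drifts, each bounded by `2 * C`, is
integrated. This deterministic bound supplies the integrability and domination used below. -/
theorem abs_sub_le (hX : IsApproxSolution P W b₀ φ σ x₀ T ρ X Y)
    (hX' : IsApproxSolution P W b₀ φ σ x₀ T ρ' X' Y') (hc : IsCoefficientPair b₀ φ C L) :
    ∀ᵐ ω ∂P, ∀ t ∈ Icc 0 T, |X t ω - X' t ω| ≤ 4 * C * T := by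
  filter_upwards [hX.sub_eq_integral hX' hc] with ω h t ht
  rw [h t ht]
  refine (abs_integral_drift_sub_le hc Y Y' ω 0 t).trans ?_
  rw [sub_zero, abs_of_nonneg ht.1]
  exact mul_le_mul_of_nonneg_left ht.2 (mul_nonneg (by norm_num) hc.bound_nonneg)

theorem integrable_sub (hX : IsApproxSolution P W b₀ φ σ x₀ T ρ X Y)
    (hX' : IsApproxSolution P W b₀ φ σ x₀ T ρ' X' Y') (hc : IsCoefficientPair b₀ φ C L)
    {t : ℝ} (ht : t ∈ Icc 0 T) : Integrable (fun ω => X t ω - X' t ω) P := by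
  refine Integrable.of_bound (hX.measurable_sub_process hX' t).aestronglyMeasurable (4 * C * T) ?_
  filter_upwards [hX.abs_sub_le hX' hc] with ω h using h t ht

theorem integrable_sub_sq (hX : IsApproxSolution P W b₀ φ σ x₀ T ρ X Y)
    (hX' : IsApproxSolution P W b₀ φ σ x₀ T ρ' X' Y') (hc : IsCoefficientPair b₀ φ C L)
    {t : ℝ} (ht : t ∈ Icc 0 T) : Integrable (fun ω => (X t ω - X' t ω) ^ 2) P := by
  refine Integrable.of_bound ((hX.measurable_sub_process hX' t).pow_const 2).aestronglyMeasurable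
    ((4 * C * T) ^ 2) ?_
  filter_upwards [hX.abs_sub_le hX' hc] with ω h
  rw [Real.norm_eq_abs, abs_pow]
  exact pow_le_pow_left₀ (abs_nonneg _) (h t ht) 2

theorem integrable_frozen_sub (hX : IsApproxSolution P W b₀ φ σ x₀ T ρ X Y)
    (hX' : IsApproxSolution P W b₀ φ σ x₀ T ρ' X' Y') (hc : IsCoefficientPair b₀ φ C L)
    {t : ℝ} (ht : t ∈ Icc 0 T) : Integrable (fun ω => Y t ω - Y' t ω) P := by
  have := ((hX.integrable_sub hX' hc ht).sub (hX.integrable_error t ht)).add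
    (hX'.integrable_error t ht)
  refine this.congr (ae_of_all _ fun ω => ?_)
  simp

theorem integral_abs_frozen_sub_le (hX : IsApproxSolution P W b₀ φ σ x₀ T ρ X Y)
    (hX' : IsApproxSolution P W b₀ φ σ x₀ T ρ' X' Y') (hc : IsCoefficientPair b₀ φ C L)
    {t : ℝ} (ht : t ∈ Icc 0 T) :
    ∫ ω, |Y t ω - Y' t ω| ∂P ≤ (∫ ω, |X t ω - X' t ω| ∂P) + ρ + ρ' := by
  have hD := (hX.integrable_sub hX' hc ht).abs
  have hE := (hX.integrable_error t ht).abs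
  have hE' := (hX'.integrable_error t ht).abs
  calc ∫ ω, |Y t ω - Y' t ω| ∂P
      ≤ ∫ ω, (|X t ω - X' t ω| + |X t ω - Y t ω| + |X' t ω - Y' t ω|) ∂P := by
        apply integral_mono (hX.integrable_frozen_sub hX' hc ht).abs ((hD.fun_add hE).fun_add hE')
        intro ω
        dsimp only
        have : Y t ω - Y' t ω = (X t ω - X' t ω) - (X t ω - Y t ω) + (X' t ω - Y' t ω) := by ring
        rw [this]
        exact (abs_add_le _ _).trans (add_le_add_left (abs_sub _ _) _)
    _ = (∫ ω, |X t ω - X' t ω| ∂P) + (∫ ω, |X t ω - Y t ω| ∂P) + ∫ ω, |X' t ω - Y' t ω| ∂P := by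
        rw [integral_add (hD.fun_add hE) hE', integral_add hD hE]
    _ ≤ _ := by
        have h1 := hX.integral_error_le t ht
        have h2 := hX'.integral_error_le t ht
        linarith

/-- Expand the nonnegative mean of `(|f| - m) ^ 2`, where `m` is the mean of `|f|`. -/
theorem sq_integral_abs_le {f : Ω → ℝ} (hf : Integrable f P)
    (hf2 : Integrable (fun ω => f ω ^ 2) P) : (∫ ω, |f ω| ∂P) ^ 2 ≤ ∫ ω, f ω ^ 2 ∂P := by
  set m := ∫ ω, |f ω| ∂P
  have h : 0 ≤ ∫ ω, (f ω ^ 2 - 2 * m * |f ω| + m ^ 2) ∂P := by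
    refine integral_nonneg fun ω => ?_
    have : f ω ^ 2 - 2 * m * |f ω| + m ^ 2 = (|f ω| - m) ^ 2 := by
      rw [sub_sq, sq_abs]; ring
    dsimp only [Pi.zero_apply]
    rw [this]
    positivity
  rw [integral_add (show Integrable (fun ω => f ω ^ 2 - 2 * m * |f ω|) P from
      hf2.sub (hf.abs.const_mul _)) (integrable_const _),
    integral_sub hf2 (hf.abs.const_mul _), integral_const_mul] at h
  simp only [integral_const, probReal_univ, smul_eq_mul, one_mul] at h
  change 0 ≤ _ - 2 * m * m + m ^ 2 at h
  linarith

/-- Write `D` for the distance of `X` and `X'`, and `m` for its mean. Terms linear in the errors are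
multiplied by `D ≤ 4 * C * T`. The remaining `L * D ^ 2 + L * D * m` is split by Young's inequality,
giving the coefficients `3 / 2 * L` and `L / 2`. -/
theorem mul_drift_sub_le (hX : IsApproxSolution P W b₀ φ σ x₀ T ρ X Y)
    (hX' : IsApproxSolution P W b₀ φ σ x₀ T ρ' X' Y') (hc : IsCoefficientPair b₀ φ C L)
    {t : ℝ} (ht : t ∈ Icc 0 T) {ω : Ω} (hω : |X t ω - X' t ω| ≤ 4 * C * T) :
    (X t ω - X' t ω) * (lawDrift P b₀ φ (Y t) (Y t ω) - lawDrift P b₀ φ (Y' t) (Y' t ω))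
      ≤ (2 * C + 4 * C * T * L) * (|X t ω - Y t ω| + |X' t ω - Y' t ω| + (ρ + ρ'))
        + 3 / 2 * L * (X t ω - X' t ω) ^ 2 + L / 2 * ∫ ω', (X t ω' - X' t ω') ^ 2 ∂P := by
  have hC := hc.bound_nonneg
  have hL := hc.lip_nonneg
  have hρ : 0 ≤ ρ := hX.error_nonneg (ht.1.trans ht.2)
  have hρ' : 0 ≤ ρ' := hX'.error_nonneg (ht.1.trans ht.2)
  have h1 := hc.mul_lawDrift_sub_le (P := P) (Y := Y t) (Y' := Y' t)
    (hX.measurable_frozen.comp measurable_prodMk_left)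
    (hX'.measurable_frozen.comp measurable_prodMk_left) (hX.integrable_frozen_sub hX' hc ht)
    (X t ω) (X' t ω) (Y t ω) (Y' t ω)
  have h2 := hX.integral_abs_frozen_sub_le hX' hc ht
  have h3 : |Y t ω - Y' t ω| ≤ |X t ω - X' t ω| + |X t ω - Y t ω| + |X' t ω - Y' t ω| := by
    have : Y t ω - Y' t ω = (X t ω - X' t ω) - (X t ω - Y t ω) + (X' t ω - Y' t ω) := by ring
    rw [this]
    exact (abs_add_le _ _).trans (add_le_add_left (abs_sub _ _) _)
  have h4 := sq_integral_abs_le (hX.integrable_sub hX' hc ht) (hX.integrable_sub_sq hX' hc ht)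
  refine h1.trans ?_
  rw [← sq_abs (X t ω - X' t ω)]
  set D := |X t ω - X' t ω|
  set e := |X t ω - Y t ω|
  set e' := |X' t ω - Y' t ω|
  set m := ∫ ω, |X t ω - X' t ω| ∂P
  set v := ∫ ω', (X t ω' - X' t ω') ^ 2 ∂P
  have hD : 0 ≤ D := abs_nonneg _
  have he : 0 ≤ e := abs_nonneg _
  have he' : 0 ≤ e' := abs_nonneg _
  have h5 : D * (L * (|Y t ω - Y' t ω| + ∫ ω, |Y t ω - Y' t ω| ∂P))
      ≤ D * (L * ((D + e + e') + (m + ρ + ρ'))) := by gcongr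
  have h6 : D * (L * (e + e' + (ρ + ρ'))) ≤ 4 * C * T * (L * (e + e' + (ρ + ρ'))) := by gcongr
  have h7 : 0 ≤ L * ((D - m) ^ 2) := by positivity
  have h8 : L * m ^ 2 ≤ L * v := by gcongr
  have h9 : 0 ≤ 2 * C * (ρ + ρ') := by positivity
  have h10 : D * (L * ((D + e + e') + (m + ρ + ρ')))
    = D * (L * (e + e' + (ρ + ρ'))) + L * D ^ 2 + L * (D * m) := by ring
  have h11 : L * ((D - m) ^ 2) = L * D ^ 2 + L * m ^ 2 - 2 * (L * (D * m)) := by ring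
  have h12 : (2 * C + 4 * C * T * L) * (e + e' + (ρ + ρ'))
    = 2 * C * (e + e') + 2 * C * (ρ + ρ') + 4 * C * T * (L * (e + e' + (ρ + ρ'))) := by ring
  linarith

/-- Pathwise stability of approximate solutions, given a bound on their mean square distance. -/
theorem sq_sub_le_of_path (hX : IsApproxSolution P W b₀ φ σ x₀ T ρ X Y)
    (hX' : IsApproxSolution P W b₀ φ σ x₀ T ρ' X' Y') (hc : IsCoefficientPair b₀ φ C L)
    {V : ℝ} (hV : ∀ t ∈ Icc 0 T, ∫ ω, (X t ω - X' t ω) ^ 2 ∂P ≤ V) :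
    ∀ᵐ ω ∂P, ∀ δ, (∀ t ∈ Icc 0 T, |X t ω - Y t ω| + |X' t ω - Y' t ω| ≤ δ) →
      ∀ t ∈ Icc 0 T, (X t ω - X' t ω) ^ 2
        ≤ 2 * ((2 * C + 4 * C * T * L) * (δ + (ρ + ρ')) + L / 2 * V) * T
          * Real.exp (2 * (3 / 2 * L) * T) := by
  filter_upwards [hX.sub_eq_integral hX' hc, hX.abs_sub_le hX' hc] with ω h hb δ hδ t ht
  have hT : 0 ≤ T := ht.1.trans ht.2
  have hC := hc.bound_nonneg
  have hL := hc.lip_nonneg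
  have hρ : 0 ≤ ρ := hX.error_nonneg hT
  have hρ' : 0 ≤ ρ' := hX'.error_nonneg hT
  have hV0 : 0 ≤ V := (integral_nonneg fun _ => sq_nonneg _).trans (hV t ht)
  have hδ0 : 0 ≤ δ := (by positivity : 0 ≤ |X t ω - Y t ω| + |X' t ω - Y' t ω|).trans (hδ t ht)
  -- The mean square term is frozen at its bound `V` and joins the source `r`; only the pathwise
  -- square is left to Grönwall.
  have key := sq_integral_le_of_mul_le (T := T) (k := 3 / 2 * L)
    (r := (2 * C + 4 * C * T * L) * (δ + (ρ + ρ')) + L / 2 * V)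
    (γ := fun s => lawDrift P b₀ φ (Y s) (Y s ω) - lawDrift P b₀ φ (Y' s) (Y' s ω))
    (by positivity) (by positivity)
    ((hc.intervalIntegrable_lawDrift hX.measurable_frozen ω 0 T).sub
      (hc.intervalIntegrable_lawDrift hX'.measurable_frozen ω 0 T)) ?_ t ht
  · rwa [← h t ht] at key
  · intro s hs
    rw [← h s hs]
    refine (hX.mul_drift_sub_le hX' hc hs (hb s hs)).trans ?_
    have h1 : (2 * C + 4 * C * T * L) * (|X s ω - Y s ω| + |X' s ω - Y' s ω| + (ρ + ρ'))
        ≤ (2 * C + 4 * C * T * L) * (δ + (ρ + ρ')) := by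
      have := hδ s hs
      gcongr
    have h2 : L / 2 * ∫ ω', (X s ω' - X' s ω') ^ 2 ∂P ≤ L / 2 * V := by
      have := hV s hs
      gcongr
    linarith

theorem integrable_prod_of_integral_abs_le {f : ℝ × Ω → ℝ} (hf : Measurable f) {B t : ℝ}
    (htT : t ≤ T) (hi : ∀ s ∈ Icc 0 T, Integrable (fun ω => f (s, ω)) P)
    (hB : ∀ s ∈ Icc 0 T, ∫ ω, |f (s, ω)| ∂P ≤ B) :
    Integrable f ((volume.restrict (Ioc 0 t)).prod P) := by
  have hsub : ∀ s ∈ Ioc 0 t, s ∈ Icc 0 T := fun s hs => ⟨hs.1.le, hs.2.trans htT⟩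
  rw [integrable_prod_iff hf.aestronglyMeasurable]
  refine ⟨ae_restrict_of_forall_mem measurableSet_Ioc fun s hs => hi s (hsub s hs), ?_⟩
  refine Integrable.of_bound (C := B) hf.aestronglyMeasurable.norm.integral_prod_right' ?_
  refine ae_restrict_of_forall_mem measurableSet_Ioc fun s hs => ?_
  rw [Real.norm_of_nonneg (integral_nonneg fun _ => norm_nonneg _)]
  exact hB s (hsub s hs)

/-- Supplies the continuity that Grönwall requires of the mean square distance. -/
theorem continuousOn_integral_sub_sq (hX : IsApproxSolution P W b₀ φ σ x₀ T ρ X Y)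
    (hX' : IsApproxSolution P W b₀ φ σ x₀ T ρ' X' Y') (hc : IsCoefficientPair b₀ φ C L) :
    ContinuousOn (fun t => ∫ ω, (X t ω - X' t ω) ^ 2 ∂P) (Icc 0 T) := by
  apply continuousOn_of_dominated (bound := fun _ => (4 * C * T) ^ 2)
  · exact fun t _ => ((hX.measurable_sub_process hX' t).pow_const 2).aestronglyMeasurable
  · intro t ht
    filter_upwards [hX.abs_sub_le hX' hc] with ω h
    rw [Real.norm_eq_abs, abs_pow]
    exact pow_le_pow_left₀ (abs_nonneg _) (h t ht) 2
  · exact integrable_const _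
  · filter_upwards [hX.sub_eq_integral hX' hc] with ω h
    refine ContinuousOn.pow ?_ 2
    refine ContinuousOn.congr ?_ h
    intro t ht
    have hT : 0 ≤ T := ht.1.trans ht.2
    have hac := ((hc.intervalIntegrable_lawDrift (P := P) hX.measurable_frozen ω 0 T).sub
      (hc.intervalIntegrable_lawDrift (P := P) hX'.measurable_frozen ω 0
        T)).absolutelyContinuousOnInterval_intervalIntegral (c := 0) (by simp)
    have := hac.continuousOn
    rw [uIcc_of_le hT] at this
    exact this t ht

/-- Mean square stability of approximate solutions. -/
theorem integral_sub_sq_le (hX : IsApproxSolution P W b₀ φ σ x₀ T ρ X Y)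
    (hX' : IsApproxSolution P W b₀ φ σ x₀ T ρ' X' Y') (hc : IsCoefficientPair b₀ φ C L) :
    ∀ t ∈ Icc 0 T, ∫ ω, (X t ω - X' t ω) ^ 2 ∂P
      ≤ 4 * (2 * C + 4 * C * T * L) * T * (ρ + ρ') * Real.exp (4 * L * T) := by
  intro t₀ ht₀
  have hT : 0 ≤ T := ht₀.1.trans ht₀.2
  have hC := hc.bound_nonneg
  have hL := hc.lip_nonneg
  have hρ : 0 ≤ ρ := hX.error_nonneg hT
  have hρ' : 0 ≤ ρ' := hX'.error_nonneg hT
  set K := 2 * C + 4 * C * T * L with hK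
  have hK0 : 0 ≤ K := by positivity
  set v : ℝ → ℝ := fun t => ∫ ω, (X t ω - X' t ω) ^ 2 ∂P with hv
  have hvc : ContinuousOn v (Icc 0 T) := hX.continuousOn_integral_sub_sq hX' hc
  -- In expectation the errors and their bounds add up to `2 * K * (ρ + ρ')`, and `3 / 2 * L + L /
  -- 2` to `2 * L`; the energy identity doubles both.
  have hgr := le_mul_exp_of_le_add_mul_integral (u := v) (A := 4 * K * T * (ρ + ρ')) (K := 4 * L)
    (by positivity) hvc ?_ t₀ ht₀
  · refine hgr.trans ?_
    have : Real.exp (4 * L * t₀) ≤ Real.exp (4 * L * T) := by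
      apply Real.exp_le_exp.2
      exact mul_le_mul_of_nonneg_left ht₀.2 (by positivity)
    exact mul_le_mul_of_nonneg_left this (by positivity)
  intro t ht
  have hsub : ∀ s ∈ Ioc 0 t, s ∈ Icc 0 T := fun s hs => ⟨hs.1.le, hs.2.trans ht.2⟩
  have hvi : Integrable v (volume.restrict (Ioc 0 t)) :=
    ((hvc.mono (Icc_subset_Icc_right ht.2)).integrableOn_Icc).mono_set Ioc_subset_Icc_self
  have mD : Measurable fun p : ℝ × Ω => (X p.1 p.2 - X' p.1 p.2) ^ 2 :=
    (hX.measurable_process.sub hX'.measurable_process).pow_const 2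
  have me : Measurable fun p : ℝ × Ω => |X p.1 p.2 - Y p.1 p.2| :=
    (hX.measurable_process.sub hX.measurable_frozen).abs
  have me' : Measurable fun p : ℝ × Ω => |X' p.1 p.2 - Y' p.1 p.2| :=
    (hX'.measurable_process.sub hX'.measurable_frozen).abs
  have iD := integrable_prod_of_integral_abs_le (P := P) (B := (4 * C * T) ^ 2) mD ht.2
    (fun s hs => hX.integrable_sub_sq hX' hc hs) (by
      intro s hs
      have : ∀ᵐ ω ∂P, ‖|(X s ω - X' s ω) ^ 2|‖ ≤ (4 * C * T) ^ 2 := by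
        filter_upwards [hX.abs_sub_le hX' hc] with ω h
        rw [Real.norm_eq_abs, abs_abs, abs_pow]
        exact pow_le_pow_left₀ (abs_nonneg _) (h s hs) 2
      have := norm_integral_le_of_norm_le_const this
      rw [probReal_univ, mul_one] at this
      exact (le_abs_self _).trans this)
  have ie := integrable_prod_of_integral_abs_le (P := P) (B := ρ) me ht.2
    (fun s hs => (hX.integrable_error s hs).abs)
    (fun s hs => by simpa only [abs_abs] using hX.integral_error_le s hs)
  have ie' := integrable_prod_of_integral_abs_le (P := P) (B := ρ') me' ht.2
    (fun s hs => (hX'.integrable_error s hs).abs)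
    (fun s hs => by simpa only [abs_abs] using hX'.integral_error_le s hs)
  set H : ℝ × Ω → ℝ := fun p => K * (|X p.1 p.2 - Y p.1 p.2| + |X' p.1 p.2 - Y' p.1 p.2| + (ρ + ρ'))
    + 3 / 2 * L * (X p.1 p.2 - X' p.1 p.2) ^ 2 + L / 2 * v p.1 with hH
  have iH : Integrable H ((volume.restrict (Ioc 0 t)).prod P) :=
    ((((ie.add ie').add (integrable_const (ρ + ρ'))).const_mul K).add
      (iD.const_mul (3 / 2 * L))).add ((hvi.comp_fst P).const_mul (L / 2))
  have hpath : ∀ᵐ ω ∂P, (X t ω - X' t ω) ^ 2 ≤ 2 * ∫ s in Ioc 0 t, H (s, ω) := by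
    filter_upwards [hX.sub_eq_integral hX' hc, hX.abs_sub_le hX' hc, iH.prod_left_ae]
      with ω h hb hi
    have hγ := (hc.intervalIntegrable_lawDrift (P := P) hX.measurable_frozen ω 0 t).sub
      (hc.intervalIntegrable_lawDrift (P := P) hX'.measurable_frozen ω 0 t)
    rw [h t ht, sq_intervalIntegral_eq hγ, intervalIntegral.integral_of_le ht.1]
    refine mul_le_mul_of_nonneg_left ?_ zero_le_two
    refine setIntegral_mono_on ?_ hi measurableSet_Ioc ?_
    · have := hγ.absolutelyContinuousOnInterval_intervalIntegral (c := 0) (by simp)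
      exact (intervalIntegrable_iff_integrableOn_Ioc_of_le ht.1).1
        (hγ.continuousOn_mul this.continuousOn)
    · intro s hs
      rw [← h s (hsub s hs)]
      exact hX.mul_drift_sub_le hX' hc (hsub s hs) (hb s (hsub s hs))
  calc v t ≤ ∫ ω, 2 * (∫ s in Ioc 0 t, H (s, ω)) ∂P :=
        integral_mono_ae (hX.integrable_sub_sq hX' hc ht) (iH.integral_prod_right.const_mul 2) hpath
    _ = 2 * ∫ s in Ioc 0 t, ∫ ω, H (s, ω) ∂P := by
        rw [integral_const_mul, integral_integral_swap (f := fun s ω => H (s, ω)) iH]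
    _ ≤ 2 * ∫ s in Ioc 0 t, (2 * K * (ρ + ρ') + 2 * L * v s) := by
        refine mul_le_mul_of_nonneg_left ?_ zero_le_two
        refine setIntegral_mono_on iH.integral_prod_left
          ((integrable_const _).add (hvi.const_mul _)) measurableSet_Ioc fun s hs => ?_
        have he := (hX.integrable_error s (hsub s hs)).abs
        have he' := (hX'.integrable_error s (hsub s hs)).abs
        have hD := hX.integrable_sub_sq hX' hc (hsub s hs)
        have h1 := hX.integral_error_le s (hsub s hs)
        have h2 := hX'.integral_error_le s (hsub s hs)
        simp only [hH]
        rw [integral_add ((((he.fun_add he').fun_add (integrable_const (ρ + ρ'))).const_mul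
            K).fun_add (hD.const_mul (3 / 2 * L))) (integrable_const _),
          integral_add (((he.fun_add he').fun_add (integrable_const (ρ + ρ'))).const_mul K)
            (hD.const_mul (3 / 2 * L)), integral_const_mul, integral_const_mul,
          integral_add (he.fun_add he') (integrable_const _), integral_add he he']
        simp only [integral_const, probReal_univ, smul_eq_mul, one_mul]
        change K * _ + 3 / 2 * L * v s + L / 2 * v s ≤ _
        have := mul_le_mul_of_nonneg_left (add_le_add_left (add_le_add h1 h2) (ρ + ρ')) hK0
        linarith
    _ = 4 * K * t * (ρ + ρ') + 4 * L * ∫ s in (0 : ℝ)..t, v s := by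
        rw [integral_add (integrable_const _) (hvi.const_mul _), integral_const_mul (2 * L),
          intervalIntegral.integral_of_le ht.1]
        simp only [integral_const, smul_eq_mul, measureReal_restrict_apply_univ,
          Real.volume_real_Ioc_of_le ht.1]
        ring
    _ ≤ _ := by
        have := ht.2
        gcongr

end IsApproxSolution


/-! ### Continuous modifications and the time Brownian paths spend at a level -/

/-- The path is set to zero on a measurable null set. That set need not belong to the filtration, so
adaptedness may be lost: the modification serves only for estimates. -/
theorem exists_continuous_modification {Ω ι : Type*} {mΩ : MeasurableSpace Ω} {P : Measure Ω}
    [TopologicalSpace ι] {Z : ι → Ω → ℝ} (hm : ∀ t, Measurable (Z t))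
    (hc : ∀ᵐ ω ∂P, Continuous fun t => Z t ω) :
    ∃ Z' : ι → Ω → ℝ, (∀ ω, Continuous fun t => Z' t ω) ∧ (∀ t, Measurable (Z' t)) ∧
      ∀ᵐ ω ∂P, ∀ t, Z' t ω = Z t ω := by
  obtain ⟨N, hN, hNm, hN0⟩ := exists_measurable_superset_of_null (ae_iff.1 hc)
  refine ⟨fun t => Nᶜ.indicator (Z t), fun ω => ?_, fun t => (hm t).indicator hNm.compl, ?_⟩
  · by_cases h : ω ∈ N
    · simpa [h] using continuous_const
    · have : Continuous fun t => Z t ω := by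
        by_contra hn
        exact h (hN hn)
      simpa [h] using this
  · have : ∀ᵐ ω ∂P, ω ∉ N := measure_eq_zero_iff_ae_notMem.1 hN0
    filter_upwards [this] with ω h t
    simp [h]

theorem gaussianPDFReal_le_inv_sqrt (v : NNReal) (x : ℝ) :
    gaussianPDFReal 0 v x ≤ (√(2 * Real.pi * v))⁻¹ := by
  rw [gaussianPDFReal]
  refine mul_le_of_le_one_right (by positivity) (Real.exp_le_one_iff.2 ?_)
  rw [neg_div]
  exact neg_nonpos.2 (by positivity)

/-- The density is at most `1 / √(2πv)` on an interval of length `2r`, and `2 ≤ √(2π)`. -/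
theorem gaussianReal_abs_le_le {v : NNReal} (hv : v ≠ 0) {r : ℝ} (hr : 0 ≤ r) :
    gaussianReal 0 v {x | |x| ≤ r} ≤ ENNReal.ofReal (r / √v) := by
  rw [gaussianReal_apply 0 hv]
  have hset : {x : ℝ | |x| ≤ r} = Icc (-r) r := by ext x; simp [abs_le]
  have hv0 : (0 : ℝ) < v := NNReal.coe_pos.2 (pos_iff_ne_zero.2 hv)
  calc ∫⁻ x in {x | |x| ≤ r}, gaussianPDF 0 v x
      ≤ ∫⁻ x in {x : ℝ | |x| ≤ r}, ENNReal.ofReal (√(2 * Real.pi * v))⁻¹ :=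
        lintegral_mono fun x => ENNReal.ofReal_le_ofReal (gaussianPDFReal_le_inv_sqrt v x)
    _ = ENNReal.ofReal ((√(2 * Real.pi * v))⁻¹ * (2 * r)) := by
        rw [setLIntegral_const, hset, Real.volume_Icc, ← ENNReal.ofReal_mul (by positivity)]
        ring_nf
    _ ≤ ENNReal.ofReal (r / √v) := by
        apply ENNReal.ofReal_le_ofReal
        have h1 : 2 * √v ≤ √(2 * Real.pi * v) := by
          apply Real.le_sqrt_of_sq_le
          rw [mul_pow, Real.sq_sqrt hv0.le]
          nlinarith [Real.pi_gt_three]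
        have h2 : 0 < √(v : ℝ) := Real.sqrt_pos.2 hv0
        rw [inv_mul_eq_div, div_le_div_iff₀ (by linarith) h2]
        nlinarith

/-- A process on `[0, T]`, indexed by `ℝ` for convenience, with continuous paths and the Gaussian
increments of Brownian motion. -/
structure IsGaussianPath {Ω : Type*} {mΩ : MeasurableSpace Ω} (P : Measure Ω) (T : ℝ)
    (W : ℝ → Ω → ℝ) : Prop where
  continuous_path : ∀ ω, Continuous fun t => W t ω
  measurable_coord : ∀ t, Measurable (W t)
  map_sub : ∀ s ∈ Icc 0 T, ∀ t ∈ Icc 0 T, s ≤ t →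
    P.map (fun ω => W t ω - W s ω) = gaussianReal 0 (t - s).toNNReal

namespace IsGaussianPath

variable {Ω : Type*} {mΩ : MeasurableSpace Ω} {P : Measure Ω} {T : ℝ} {W : ℝ → Ω → ℝ}

theorem measurable_uncurry (hW : IsGaussianPath P T W) :
    Measurable (Function.uncurry W) :=
  measurable_uncurry_of_continuous_of_measurable hW.continuous_path hW.measurable_coord

theorem measurable_sub (hW : IsGaussianPath P T W) (s t : ℝ) :
    Measurable fun ω => W t ω - W s ω :=
  (hW.measurable_coord t).sub (hW.measurable_coord s)

theorem memLp_sub (hW : IsGaussianPath P T W) {s t : ℝ} (hs : s ∈ Icc 0 T)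
    (ht : t ∈ Icc 0 T) (hst : s ≤ t) : MemLp (fun ω => W t ω - W s ω) 2 P := by
  have h := memLp_id_gaussianReal (μ := 0) (v := (t - s).toNNReal) 2
  rw [← hW.map_sub s hs t ht hst] at h
  exact (memLp_map_measure_iff aestronglyMeasurable_id
    (hW.measurable_sub s t).aemeasurable).1 h

theorem integral_sub_sq (hW : IsGaussianPath P T W) {s t : ℝ} (hs : s ∈ Icc 0 T)
    (ht : t ∈ Icc 0 T) (hst : s ≤ t) : ∫ ω, (W t ω - W s ω) ^ 2 ∂P = t - s := by
  have h1 := variance_id_gaussianReal (μ := 0) (v := (t - s).toNNReal)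
  rw [variance_eq_integral measurable_id.aemeasurable] at h1
  simp only [id, integral_id_gaussianReal, sub_zero] at h1
  rw [Real.coe_toNNReal _ (sub_nonneg.2 hst), ← hW.map_sub s hs t ht hst, integral_map
    (hW.measurable_sub s t).aemeasurable (by fun_prop)] at h1
  exact h1

/-- The times at which a path moves at most at speed `m` over the next `u` units of time. -/
def slowTimes (W : ℝ → Ω → ℝ) (T m u : ℝ) : Set (ℝ × Ω) :=
  {p | p.1 ∈ Icc 0 T ∧ p.1 + u ≤ T ∧ |W (p.1 + u) p.2 - W p.1 p.2| ≤ m * u}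

theorem measurableSet_slowTimes (hW : IsGaussianPath P T W) (m u : ℝ) :
    MeasurableSet (slowTimes W T m u) := by
  have h1 : Measurable fun p : ℝ × Ω => W (p.1 + u) p.2 :=
    hW.measurable_uncurry.comp ((measurable_fst.add_const u).prodMk measurable_snd)
  have h2 : Measurable fun p : ℝ × Ω => W p.1 p.2 := hW.measurable_uncurry
  exact (measurable_fst measurableSet_Icc).inter
    ((measurableSet_le (measurable_fst.add_const u) measurable_const).inter
      (measurableSet_le (h1.sub h2).abs measurable_const))

theorem measure_abs_sub_le_le (hW : IsGaussianPath P T W) {s u m : ℝ} (hm : 0 ≤ m)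
    (hs : s ∈ Icc 0 T) (hu : 0 < u) (hsu : s + u ≤ T) :
    P {ω | |W (s + u) ω - W s ω| ≤ m * u} ≤ ENNReal.ofReal (m * √u) := by
  have hmap := hW.map_sub s hs (s + u) ⟨by linarith [hs.1], hsu⟩ (by linarith)
  have hset : {ω | |W (s + u) ω - W s ω| ≤ m * u}
      = (fun ω => W (s + u) ω - W s ω) ⁻¹' {x | |x| ≤ m * u} := rfl
  rw [hset, ← Measure.map_apply (hW.measurable_sub s (s + u))
    (measurableSet_le measurable_abs measurable_const), hmap, add_sub_cancel_left]
  refine (gaussianReal_abs_le_le (by simpa using hu) (by positivity)).trans ?_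
  rw [Real.coe_toNNReal _ hu.le, mul_div_assoc, Real.div_sqrt]

variable [IsProbabilityMeasure P]

theorem integrable_sub (hW : IsGaussianPath P T W) {s t : ℝ} (hs : s ∈ Icc 0 T)
    (ht : t ∈ Icc 0 T) (hst : s ≤ t) : Integrable (fun ω => W t ω - W s ω) P :=
  (hW.memLp_sub hs ht hst).integrable one_le_two

theorem integral_abs_sub_le (hW : IsGaussianPath P T W) {s t : ℝ} (hs : s ∈ Icc 0 T)
    (ht : t ∈ Icc 0 T) (hst : s ≤ t) : ∫ ω, |W t ω - W s ω| ∂P ≤ √(t - s) := by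
  apply Real.le_sqrt_of_sq_le
  rw [← hW.integral_sub_sq hs ht hst]
  exact IsApproxSolution.sq_integral_abs_le (hW.integrable_sub hs ht hst)
    (hW.memLp_sub hs ht hst).integrable_sq

/-- By Fubini, the mean time spent in slow motion is the time integral of probabilities of size `m *
√u`: Brownian increments are of order `√u`, much larger than `m * u`. -/
theorem lintegral_volume_slowTimes_le (hW : IsGaussianPath P T W) {m u : ℝ} (hm : 0 ≤ m)
    (hu : 0 < u) :
    ∫⁻ ω, volume ((fun s => (s, ω)) ⁻¹' slowTimes W T m u) ∂P
      ≤ ENNReal.ofReal (m * √u) * ENNReal.ofReal T := by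
  have hS := hW.measurableSet_slowTimes m u
  rw [← Measure.prod_apply_symm hS, Measure.prod_apply hS]
  calc ∫⁻ s, P (Prod.mk s ⁻¹' slowTimes W T m u)
      ≤ ∫⁻ s, (Icc 0 T).indicator (fun _ => ENNReal.ofReal (m * √u)) s := by
        refine lintegral_mono fun s => ?_
        by_cases hs : s ∈ Icc 0 T ∧ s + u ≤ T
        · rw [indicator_of_mem hs.1]
          exact (measure_mono fun ω hω => hω.2.2).trans
            (hW.measure_abs_sub_le_le hm hs.1 hu hs.2)
        · have : Prod.mk s ⁻¹' slowTimes W T m u = ∅ :=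
            eq_empty_of_forall_notMem fun ω hω => hs ⟨hω.1, hω.2.1⟩
          rw [this, measure_empty]
          exact zero_le
    _ = _ := by
        rw [lintegral_indicator measurableSet_Icc, setLIntegral_const, Real.volume_Icc, sub_zero]

/-- Fatou's lemma. A lower limit suffices later, since a single small step is enough to reach a
contradiction. -/
theorem ae_liminf_volume_slowTimes (hW : IsGaussianPath P T W) {m : ℝ} (hm : 0 ≤ m) :
    ∀ᵐ ω ∂P, liminf (fun n : ℕ => volume ((fun s => (s, ω)) ⁻¹' slowTimes W T m (1 / (n + 1))))
      atTop = 0 := by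
  have hmeas : ∀ n : ℕ, Measurable fun ω =>
      volume ((fun s => (s, ω)) ⁻¹' slowTimes W T m (1 / (n + 1))) := fun n =>
    measurable_measure_prodMk_right (hW.measurableSet_slowTimes m _)
  have hlim : Tendsto (fun n : ℕ => ENNReal.ofReal (m * √(1 / ((n : ℝ) + 1))) * ENNReal.ofReal T)
      atTop (𝓝 0) := by
    have h1 : Tendsto (fun n : ℕ => m * √(1 / ((n : ℝ) + 1))) atTop (𝓝 (m * √0)) :=
      (tendsto_one_div_add_atTop_nhds_zero_nat.sqrt).const_mul m
    have h2 := ENNReal.Tendsto.mul_const (b := ENNReal.ofReal T) (ENNReal.tendsto_ofReal h1)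
      (Or.inr ENNReal.ofReal_ne_top)
    simpa using h2
  have h0 : ∫⁻ ω, liminf (fun n : ℕ => volume ((fun s => (s, ω)) ⁻¹' slowTimes W T m (1 / (n + 1))))
      atTop ∂P = 0 := by
    refine le_antisymm ?_ zero_le
    refine (lintegral_liminf_le hmeas).trans ?_
    rw [← hlim.liminf_eq]
    exact liminf_le_liminf (Eventually.of_forall fun n =>
      hW.lintegral_volume_slowTimes_le hm (by positivity))
  exact (lintegral_eq_zero_iff (Measurable.liminf hmeas)).1 h0

/-- Almost every path, perturbed by any Lipschitz function, spends no time at any given level. -/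
theorem ae_forall_volume_level_eq_zero (hW : IsGaussianPath P T W) {σ : ℝ} (hσ : 0 < σ) :
    ∀ᵐ ω ∂P, ∀ (A : ℝ → ℝ) (K : ℝ), ContinuousOn A (Icc 0 T) →
      (∀ s ∈ Icc 0 T, ∀ t ∈ Icc 0 T, |A t - A s| ≤ K * |t - s|) →
      ∀ a, volume {s | s ∈ Icc 0 T ∧ A s + σ * W s ω = a} = 0 := by
  -- Only integer speeds enter, so one null set serves for all `A`, `K` and `a`. This matters
  -- because `A` will be the drift of the solution along the same path `ω`.
  have hall := ae_all_iff.2 fun m : ℕ => hW.ae_liminf_volume_slowTimes (Nat.cast_nonneg m)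
  filter_upwards [hall] with ω hω A K hAc hA a
  obtain ⟨m, hm⟩ := exists_nat_ge (K / σ)
  set S : Set ℝ := {s | s ∈ Icc 0 T ∧ A s + σ * W s ω = a} with hS
  have hSc : IsCompact S := by
    refine isCompact_Icc.of_isClosed_subset ?_ (fun s hs => hs.1)
    have : ContinuousOn (fun s => A s + σ * W s ω) (Icc 0 T) :=
      hAc.add ((hW.continuous_path ω).const_mul σ).continuousOn
    exact this.preimage_isClosed_of_isClosed isClosed_Icc (isClosed_singleton (x := a))
  have hSfin : volume S ≠ ⊤ := hSc.measure_lt_top.ne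
  -- `S` and its translate by `-u` have equal volume and both lie within `u` of `S`. At a point of
  -- their intersection the increment of `σ * W` cancels that of `A`, so the time is slow. As `u →
  -- 0`, the thickening shrinks to the compact set `S`, leaving twice `volume S` at most `volume S`.
  have hbound : ∀ u : ℝ, 0 < u → volume S + volume S ≤ volume (Metric.cthickening u S)
      + volume ((fun s => (s, ω)) ⁻¹' slowTimes W T m u) := by
    intro u hu
    have hshift : volume ((fun s => s + u) ⁻¹' S) = volume S := measure_preimage_add_right _ _ _
    have hSm : MeasurableSet S := hSc.measurableSet
    rw [← hshift]
    nth_rewrite 1 [hshift]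
    rw [← measure_union_add_inter S (hSm.preimage (measurable_add_const u))]
    refine add_le_add (measure_mono ?_) (measure_mono ?_)
    · refine union_subset (Metric.self_subset_cthickening S) fun s hs => ?_
      refine Metric.mem_cthickening_of_dist_le s (s + u) u S hs ?_
      simp [abs_of_pos hu]
    · rintro s ⟨hs, hs'⟩
      refine ⟨hs.1, hs'.1.2, ?_⟩
      have h1 : A (s + u) + σ * W (s + u) ω = a := hs'.2
      have h2 : A s + σ * W s ω = a := hs.2
      have h3 := hA s hs.1 (s + u) hs'.1
      have h4 : σ * (W (s + u) ω - W s ω) = -(A (s + u) - A s) := by linarith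
      have h5 : σ * |W (s + u) ω - W s ω| = |A (s + u) - A s| := by
        rw [← abs_neg (A (s + u) - A s), ← h4, abs_mul, abs_of_pos hσ]
      rw [add_sub_cancel_left, abs_of_pos hu, ← h5] at h3
      have h6 : |W (s + u) ω - W s ω| ≤ K / σ * u := by
        rw [div_mul_eq_mul_div, le_div_iff₀ hσ]
        linarith
      exact h6.trans (mul_le_mul_of_nonneg_right hm hu.le)
  have hthick : Tendsto (fun n : ℕ => volume (Metric.cthickening (1 / ((n : ℝ) + 1)) S)) atTop
      (𝓝 (volume S)) :=
    (tendsto_measure_cthickening_of_isCompact hSc).comp tendsto_one_div_add_atTop_nhds_zero_nat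
  by_contra hne
  have hpos : 0 < volume S := pos_iff_ne_zero.2 hne
  obtain ⟨ε, hε, hεS⟩ : ∃ ε, 0 < ε ∧ ε + ε ≤ volume S :=
    ⟨volume S / 2, ENNReal.half_pos hne, (ENNReal.add_halves _).le⟩
  have hεfin : ε ≠ ⊤ := fun h => hSfin (top_le_iff.1 (by simpa [h] using hεS))
  have hev : ∀ᶠ n : ℕ in atTop,
      volume (Metric.cthickening (1 / ((n : ℝ) + 1)) S) < volume S + ε :=
    hthick.eventually_lt_const (ENNReal.lt_add_right hSfin hε.ne')
  have hfr : ∃ᶠ n : ℕ in atTop,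
      volume ((fun s => (s, ω)) ⁻¹' slowTimes W T m (1 / ((n : ℝ) + 1))) < ε := by
    apply frequently_lt_of_liminf_lt
    · exact isCobounded_ge_of_top
    · rw [hω m]; exact hε
  obtain ⟨n, hn, hn'⟩ := (hfr.and_eventually hev).exists
  have h1 := hbound (1 / ((n : ℝ) + 1)) (by positivity)
  have h2 := h1.trans_lt (ENNReal.add_lt_add hn' hn)
  rw [add_assoc] at h2
  exact absurd (lt_of_add_lt_add_left h2) (not_lt.2 hεS)

end IsGaussianPath


/-! ### The Euler scheme as an approximate solution -/

theorem IsCoefficientPair.measurable_lawDrift {b₀ : ℝ → ℝ → ℝ} {φ : ℝ → ℝ} {C L : ℝ}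
    {Ω : Type*} {mΩ : MeasurableSpace Ω} {P : Measure Ω} [IsProbabilityMeasure P]
    (h : IsCoefficientPair b₀ φ C L) {Y : Ω → ℝ} (hY : Measurable Y) :
    Measurable (lawDrift P b₀ φ Y) := by
  have hm : Measurable fun q : ℝ × Ω => Function.uncurry b₀ (q.1, Y q.2) :=
    h.continuous_uncurry.measurable.comp (measurable_fst.prodMk (hY.comp measurable_snd))
  have := StronglyMeasurable.integral_prod_right (ν := P)
    (f := fun (x : ℝ) (ω : Ω) => b₀ x (Y ω)) hm.stronglyMeasurable
  exact this.measurable.add h.measurable_control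

theorem lawDrift_congr_ae {Ω : Type*} {mΩ : MeasurableSpace Ω} {P : Measure Ω}
    {b₀ : ℝ → ℝ → ℝ} {φ : ℝ → ℝ} {Y Y' : Ω → ℝ} (h : Y =ᵐ[P] Y') (x : ℝ) :
    lawDrift P b₀ φ Y x = lawDrift P b₀ φ Y' x := by
  unfold lawDrift
  congr 1
  apply integral_congr_ae
  filter_upwards [h] with ω hω
  rw [hω]

section Euler

variable {Ω : Type*} {mΩ : MeasurableSpace Ω}

/-- The accumulated drift of the Euler scheme of step `h` after `i` steps. -/
noncomputable def eulerSum (P : Measure Ω) (W : ℝ → Ω → ℝ) (b₀ : ℝ → ℝ → ℝ) (φ : ℝ → ℝ)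
    (σ x₀ h : ℝ) : ℕ → Ω → ℝ
  | 0 => fun _ => 0
  | i + 1 => fun ω => eulerSum P W b₀ φ σ x₀ h i ω + h * lawDrift P b₀ φ
      (fun ω' => x₀ + eulerSum P W b₀ φ σ x₀ h i ω' + σ * W (i * h) ω')
      (x₀ + eulerSum P W b₀ φ σ x₀ h i ω + σ * W (i * h) ω)

/-- The value of the Euler scheme of step `h` at time `i * h`. -/
noncomputable def eulerNode (P : Measure Ω) (W : ℝ → Ω → ℝ) (b₀ : ℝ → ℝ → ℝ) (φ : ℝ → ℝ)
    (σ x₀ h : ℝ) (i : ℕ) (ω : Ω) : ℝ :=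
  x₀ + eulerSum P W b₀ φ σ x₀ h i ω + σ * W (i * h) ω

/-- The Euler scheme of step `h`, interpolated with the driving path. -/
noncomputable def eulerPath (P : Measure Ω) (W : ℝ → Ω → ℝ) (b₀ : ℝ → ℝ → ℝ) (φ : ℝ → ℝ)
    (σ x₀ h : ℝ) (t : ℝ) (ω : Ω) : ℝ :=
  x₀ + (eulerSum P W b₀ φ σ x₀ h ⌊t / h⌋₊ ω + (t - ⌊t / h⌋₊ * h) *
    lawDrift P b₀ φ (eulerNode P W b₀ φ σ x₀ h ⌊t / h⌋₊) (eulerNode P W b₀ φ σ x₀ h ⌊t / h⌋₊ ω))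
    + σ * W t ω

variable {P : Measure Ω} {W W' : ℝ → Ω → ℝ} {b₀ : ℝ → ℝ → ℝ} {φ : ℝ → ℝ} {σ x₀ h C L T : ℝ}

theorem eulerSum_succ (i : ℕ) (ω : Ω) :
    eulerSum P W b₀ φ σ x₀ h (i + 1) ω = eulerSum P W b₀ φ σ x₀ h i ω + h *
      lawDrift P b₀ φ (eulerNode P W b₀ φ σ x₀ h i) (eulerNode P W b₀ φ σ x₀ h i ω) := rfl

theorem eulerSum_ae_eq (hW : ∀ᵐ ω ∂P, ∀ t, W t ω = W' t ω) :
    ∀ᵐ ω ∂P, ∀ i, eulerSum P W b₀ φ σ x₀ h i ω = eulerSum P W' b₀ φ σ x₀ h i ω := by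
  rw [ae_all_iff]
  intro i
  induction i with
  | zero => exact ae_of_all _ fun ω => rfl
  | succ i ih =>
    have hn : eulerNode P W b₀ φ σ x₀ h i =ᵐ[P] eulerNode P W' b₀ φ σ x₀ h i := by
      filter_upwards [ih, hW] with ω h1 h2
      rw [eulerNode, eulerNode, h1, h2]
    filter_upwards [ih, hn] with ω h1 h2
    rw [eulerSum_succ, eulerSum_succ, h1, h2, lawDrift_congr_ae hn]

/-- Allows the scheme to be driven by the adapted Brownian motion for measurability and by its
continuous modification for estimates. -/
theorem eulerPath_ae_eq (hW : ∀ᵐ ω ∂P, ∀ t, W t ω = W' t ω) :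
    ∀ᵐ ω ∂P, ∀ t, eulerPath P W b₀ φ σ x₀ h t ω = eulerPath P W' b₀ φ σ x₀ h t ω := by
  have hs := eulerSum_ae_eq (b₀ := b₀) (φ := φ) (σ := σ) (x₀ := x₀) (h := h) hW
  have hn : ∀ᵐ ω ∂P, ∀ i, eulerNode P W b₀ φ σ x₀ h i ω = eulerNode P W' b₀ φ σ x₀ h i ω := by
    filter_upwards [hs, hW] with ω h1 h2 i
    rw [eulerNode, eulerNode, h1, h2]
  filter_upwards [hs, hn, hW] with ω h1 h2 h3 t
  have h4 : eulerNode P W b₀ φ σ x₀ h ⌊t / h⌋₊ =ᵐ[P] eulerNode P W' b₀ φ σ x₀ h ⌊t / h⌋₊ := by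
    filter_upwards [hn] with ω h using h _
  rw [eulerPath, eulerPath, h1, h2, h3, lawDrift_congr_ae h4]

variable [IsProbabilityMeasure P]

/-- The σ-algebra `m` is arbitrary so that it can be taken to be `𝓕 t`: each step uses only the past
of the driving path. -/
theorem measurable_eulerSum (hc : IsCoefficientPair b₀ φ C L)
    {m : MeasurableSpace Ω} (hm : m ≤ mΩ) (i : ℕ) (hWm : ∀ j < i, Measurable[m] (W (j * h))) :
    Measurable[m] (eulerSum P W b₀ φ σ x₀ h i) := by
  induction i with
  | zero => exact measurable_const
  | succ i ih =>
    have h1 := ih fun j hj => hWm j (hj.trans (Nat.lt_succ_self i))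
    have h2 : Measurable[m] (eulerNode P W b₀ φ σ x₀ h i) :=
      (h1.const_add x₀).add ((hWm i (Nat.lt_succ_self i)).const_mul σ)
    have h3 : Measurable (lawDrift P b₀ φ (eulerNode P W b₀ φ σ x₀ h i)) :=
      hc.measurable_lawDrift (h2.mono hm le_rfl)
    exact h1.add ((h3.comp h2).const_mul h)

theorem measurable_eulerNode (hc : IsCoefficientPair b₀ φ C L)
    {m : MeasurableSpace Ω} (hm : m ≤ mΩ) (i : ℕ) (hWm : ∀ j ≤ i, Measurable[m] (W (j * h))) :
    Measurable[m] (eulerNode P W b₀ φ σ x₀ h i) :=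
  ((measurable_eulerSum hc hm i fun j hj => hWm j hj.le).const_add x₀).add
    ((hWm i le_rfl).const_mul σ)

theorem natFloor_div_mul_le (hh : 0 < h) {t : ℝ} (ht : 0 ≤ t) : ⌊t / h⌋₊ * h ≤ t :=
  (le_div_iff₀ hh).1 (Nat.floor_le (div_nonneg ht hh.le))

theorem sub_natFloor_div_mul_le (hh : 0 < h) (t : ℝ) : t - ⌊t / h⌋₊ * h ≤ h := by
  have := (div_lt_iff₀ hh).1 (Nat.lt_floor_add_one (t / h))
  linarith

theorem measurable_eulerPath (hc : IsCoefficientPair b₀ φ C L) (hh : 0 < h)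
    {m : MeasurableSpace Ω} (hm : m ≤ mΩ) {t : ℝ} (ht : 0 ≤ t)
    (hWm : ∀ s ∈ Icc 0 t, Measurable[m] (W s)) :
    Measurable[m] (eulerPath P W b₀ φ σ x₀ h t) := by
  have hj : ∀ j ≤ ⌊t / h⌋₊, Measurable[m] (W (j * h)) := fun j hj => by
    refine hWm _ ⟨by positivity, le_trans ?_ (natFloor_div_mul_le hh ht)⟩
    gcongr
  have h1 := measurable_eulerSum (P := P) (σ := σ) (x₀ := x₀) hc hm ⌊t / h⌋₊
    fun j hj' => hj j hj'.le
  have h2 := measurable_eulerNode (P := P) (σ := σ) (x₀ := x₀) hc hm ⌊t / h⌋₊ hj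
  have h3 : Measurable (lawDrift P b₀ φ (eulerNode P W b₀ φ σ x₀ h ⌊t / h⌋₊)) :=
    hc.measurable_lawDrift (h2.mono hm le_rfl)
  exact ((h1.add ((h3.comp h2).const_mul _)).const_add x₀).add
    ((hWm t ⟨ht, le_rfl⟩).const_mul σ)

theorem measurable_comp_natFloor {F : ℕ → Ω → ℝ} (hF : ∀ i, Measurable (F i)) (h : ℝ) :
    Measurable fun p : ℝ × Ω => F ⌊p.1 / h⌋₊ p.2 := by
  have h1 : Measurable fun p : ℕ × Ω => F p.1 p.2 := measurable_from_prod_countable_right hF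
  exact h1.comp ((Nat.measurable_floor.comp (measurable_fst.div_const h)).prodMk measurable_snd)

theorem measurable_uncurry_eulerNode (hc : IsCoefficientPair b₀ φ C L)
    (hW : ∀ t, Measurable (W t)) :
    Measurable (Function.uncurry fun (s : ℝ) ω => eulerNode P W b₀ φ σ x₀ h ⌊s / h⌋₊ ω) :=
  measurable_comp_natFloor (fun i => measurable_eulerNode hc le_rfl i fun _ _ => hW _) h

theorem measurable_uncurry_eulerPath (hc : IsCoefficientPair b₀ φ C L)
    (hW : Measurable (Function.uncurry W)) :
    Measurable (Function.uncurry (eulerPath P W b₀ φ σ x₀ h)) := by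
  have hWt : ∀ t, Measurable (W t) := fun t => hW.comp measurable_prodMk_left
  have h1 := measurable_comp_natFloor (fun i => measurable_eulerSum (P := P) (σ := σ) (x₀ := x₀)
    (h := h) hc le_rfl i fun _ _ => hWt _) h
  have h2 := hc.measurable_lawDrift_uncurry (P := P)
    (measurable_uncurry_eulerNode (P := P) (σ := σ) (x₀ := x₀) (h := h) hc hWt)
  have h3 : Measurable fun p : ℝ × Ω => p.1 - (⌊p.1 / h⌋₊ : ℝ) * h :=
    measurable_fst.sub ((measurable_from_nat.comp
      (Nat.measurable_floor.comp (measurable_fst.div_const h))).mul_const h)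
  exact ((h1.add (h3.mul h2)).const_add x₀).add (hW.const_mul σ)

theorem natFloor_div_eq (hh : 0 < h) {i : ℕ} {s : ℝ} (hs : s ∈ Ico (i * h) ((i + 1) * h)) :
    ⌊s / h⌋₊ = i := by
  have h0 : 0 ≤ s := le_trans (by positivity) hs.1
  rw [Nat.floor_eq_iff (div_nonneg h0 hh.le)]
  exact ⟨(le_div_iff₀ hh).2 hs.1, (div_lt_iff₀ hh).2 hs.2⟩

theorem integral_comp_natFloor (hh : 0 < h) (F : ℕ → ℝ) (i : ℕ) {t : ℝ}
    (ht : t ∈ Icc (i * h) ((i + 1) * h)) :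
    ∫ s in (i * h)..t, F ⌊s / h⌋₊ = (t - i * h) * F i := by
  -- The right endpoint is dropped because the floor already jumps to `i + 1` at `(i + 1) * h`.
  rw [intervalIntegral.integral_of_le ht.1, integral_Ioc_eq_integral_Ioo,
    setIntegral_congr_fun (g := fun _ => F i) measurableSet_Ioo]
  · rw [setIntegral_const, smul_eq_mul, Real.volume_real_Ioo_of_le ht.1]
  · intro s hs
    simp only
    rw [natFloor_div_eq hh ⟨hs.1.le, hs.2.trans_le ht.2⟩]

theorem eulerSum_eq_integral (hc : IsCoefficientPair b₀ φ C L) (hW : ∀ t, Measurable (W t))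
    (hh : 0 < h) (i : ℕ) (ω : Ω) :
    eulerSum P W b₀ φ σ x₀ h i ω = ∫ s in (0 : ℝ)..(i * h), lawDrift P b₀ φ
      (eulerNode P W b₀ φ σ x₀ h ⌊s / h⌋₊) (eulerNode P W b₀ φ σ x₀ h ⌊s / h⌋₊ ω) := by
  have hint := hc.intervalIntegrable_lawDrift (P := P)
    (measurable_uncurry_eulerNode (P := P) (σ := σ) (x₀ := x₀) (h := h) hc hW) ω
  induction i with
  | zero => simp [eulerSum]
  | succ i ih =>
    have h1 : (i : ℝ) * h ≤ (i + 1) * h := by linarith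
    have h2 := integral_comp_natFloor hh (fun i => lawDrift P b₀ φ
      (eulerNode P W b₀ φ σ x₀ h i) (eulerNode P W b₀ φ σ x₀ h i ω)) i ⟨h1, le_rfl⟩
    have h3 := intervalIntegral.integral_add_adjacent_intervals (hint 0 (i * h))
      (hint (i * h) ((i + 1) * h))
    rw [eulerSum_succ, ih, Nat.cast_succ, ← h3, h2]
    ring

theorem eulerPath_eq (hc : IsCoefficientPair b₀ φ C L) (hW : ∀ t, Measurable (W t))
    (hh : 0 < h) {t : ℝ} (ht : 0 ≤ t) (ω : Ω) :
    eulerPath P W b₀ φ σ x₀ h t ω = x₀ + (∫ s in (0 : ℝ)..t, lawDrift P b₀ φ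
      (eulerNode P W b₀ φ σ x₀ h ⌊s / h⌋₊) (eulerNode P W b₀ φ σ x₀ h ⌊s / h⌋₊ ω))
      + σ * W t ω := by
  have hint := hc.intervalIntegrable_lawDrift (P := P)
    (measurable_uncurry_eulerNode (P := P) (σ := σ) (x₀ := x₀) (h := h) hc hW) ω
  have h1 := natFloor_div_mul_le hh ht
  have h2 := sub_natFloor_div_mul_le hh t
  rw [eulerPath, eulerSum_eq_integral hc hW hh, ← intervalIntegral.integral_add_adjacent_intervals
    (hint 0 (⌊t / h⌋₊ * h)) (hint (⌊t / h⌋₊ * h) t), integral_comp_natFloor hh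
      (fun i => lawDrift P b₀ φ (eulerNode P W b₀ φ σ x₀ h i)
        (eulerNode P W b₀ φ σ x₀ h i ω)) ⌊t / h⌋₊ ⟨h1, by linarith⟩]

theorem abs_eulerPath_sub_le (hc : IsCoefficientPair b₀ φ C L) (hh : 0 < h) (hσ : 0 ≤ σ)
    {t : ℝ} (ht : 0 ≤ t) (ω : Ω) :
    |eulerPath P W b₀ φ σ x₀ h t ω - eulerNode P W b₀ φ σ x₀ h ⌊t / h⌋₊ ω|
      ≤ 2 * C * h + σ * |W t ω - W (⌊t / h⌋₊ * h) ω| := by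
  have h1 := natFloor_div_mul_le hh ht
  have h2 := sub_natFloor_div_mul_le hh t
  have h3 := hc.abs_lawDrift_le (P := P) (eulerNode P W b₀ φ σ x₀ h ⌊t / h⌋₊)
    (eulerNode P W b₀ φ σ x₀ h ⌊t / h⌋₊ ω)
  have h4 : eulerPath P W b₀ φ σ x₀ h t ω - eulerNode P W b₀ φ σ x₀ h ⌊t / h⌋₊ ω
      = (t - ⌊t / h⌋₊ * h) * lawDrift P b₀ φ (eulerNode P W b₀ φ σ x₀ h ⌊t / h⌋₊)
        (eulerNode P W b₀ φ σ x₀ h ⌊t / h⌋₊ ω) + σ * (W t ω - W (⌊t / h⌋₊ * h) ω) := by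
    have h5 : eulerNode P W b₀ φ σ x₀ h ⌊t / h⌋₊ ω
        = x₀ + eulerSum P W b₀ φ σ x₀ h ⌊t / h⌋₊ ω + σ * W (⌊t / h⌋₊ * h) ω := rfl
    rw [eulerPath]
    linarith
  rw [h4]
  refine (abs_add_le _ _).trans ?_
  rw [abs_mul, abs_mul, abs_of_nonneg hσ, abs_of_nonneg (sub_nonneg.2 h1)]
  have := mul_le_mul h2 h3 (abs_nonneg _) hh.le
  linarith

/-- Since the last node the drift has moved the scheme by at most `2 * C * h`, and the noise by at
most `σ * √h` in mean. -/
theorem isApproxSolution_eulerPath (hc : IsCoefficientPair b₀ φ C L)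
    (hW : IsGaussianPath P T W) (hh : 0 < h) (hσ : 0 ≤ σ) :
    IsApproxSolution P W b₀ φ σ x₀ T (2 * C * h + σ * √h) (eulerPath P W b₀ φ σ x₀ h)
      (fun s => eulerNode P W b₀ φ σ x₀ h ⌊s / h⌋₊) := by
  have hX := measurable_uncurry_eulerPath (P := P) (σ := σ) (x₀ := x₀) (h := h) hc
    hW.measurable_uncurry
  have hY := measurable_uncurry_eulerNode (P := P) (σ := σ) (x₀ := x₀) (h := h) hc
    hW.measurable_coord
  have hmem : ∀ t ∈ Icc 0 T, ⌊t / h⌋₊ * h ∈ Icc 0 T := fun t ht =>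
    ⟨by positivity, (natFloor_div_mul_le hh ht.1).trans ht.2⟩
  have hbi : ∀ t ∈ Icc 0 T,
      Integrable (fun ω => 2 * C * h + σ * |W t ω - W (⌊t / h⌋₊ * h) ω|) P := fun t ht =>
    (integrable_const _).add ((hW.integrable_sub (hmem t ht) ht
      (natFloor_div_mul_le hh ht.1)).abs.const_mul σ)
  have hi : ∀ t ∈ Icc 0 T, Integrable (fun ω => eulerPath P W b₀ φ σ x₀ h t ω
      - eulerNode P W b₀ φ σ x₀ h ⌊t / h⌋₊ ω) P := fun t ht => by
    refine (hbi t ht).mono' ?_ (ae_of_all _ fun ω => abs_eulerPath_sub_le hc hh hσ ht.1 ω)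
    exact ((hX.comp measurable_prodMk_left).sub
      (hY.comp measurable_prodMk_left)).aestronglyMeasurable
  refine ⟨hX, hY, ae_of_all _ fun ω t ht => eulerPath_eq hc hW.measurable_coord hh ht.1 ω,
    hi, fun t ht => ?_⟩
  refine (integral_mono (hi t ht).abs (hbi t ht)
    fun ω => abs_eulerPath_sub_le hc hh hσ ht.1 ω).trans ?_
  have hWi := hW.integrable_sub (hmem t ht) ht (natFloor_div_mul_le hh ht.1)
  rw [integral_add (integrable_const _) (hWi.abs.const_mul σ), integral_const_mul σ]
  simp only [integral_const, probReal_univ, smul_eq_mul, one_mul]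
  have h1 := hW.integral_abs_sub_le (hmem t ht) ht (natFloor_div_mul_le hh ht.1)
  have h2 := Real.sqrt_le_sqrt (sub_natFloor_div_mul_le hh t)
  have := mul_le_mul_of_nonneg_left (h1.trans h2) hσ
  linarith

/-- Uniform continuity of the fixed path on `[0, T]`; `N` depends on `ω` but not on `t`. -/
theorem exists_forall_abs_eulerPath_sub_le (hc : IsCoefficientPair b₀ φ C L)
    (hW : IsGaussianPath P T W) (hσ : 0 ≤ σ) (ω : Ω) {ε : ℝ} (hε : 0 < ε) :
    ∃ N : ℕ, ∀ n ≥ N, ∀ t ∈ Icc 0 T, |eulerPath P W b₀ φ σ x₀ (1 / ((n : ℝ) + 1)) t ω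
      - eulerNode P W b₀ φ σ x₀ (1 / ((n : ℝ) + 1)) ⌊t / (1 / ((n : ℝ) + 1))⌋₊ ω| ≤ ε := by
  have huc := isCompact_Icc.uniformContinuousOn_of_continuous
    (hW.continuous_path ω).continuousOn (s := Icc 0 T)
  rw [Metric.uniformContinuousOn_iff] at huc
  -- The factor `σ + 1` avoids dividing by zero, since here `σ` is only nonnegative.
  obtain ⟨δ, hδ, hδW⟩ := huc (ε / (2 * (σ + 1))) (by positivity)
  have h1 : ∀ᶠ n : ℕ in atTop, 1 / ((n : ℝ) + 1) < δ :=
    tendsto_one_div_add_atTop_nhds_zero_nat.eventually_lt_const hδ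
  have h2 : ∀ᶠ n : ℕ in atTop, 2 * C * (1 / ((n : ℝ) + 1)) < ε / 2 := by
    have := (tendsto_one_div_add_atTop_nhds_zero_nat (𝕜 := ℝ)).const_mul (2 * C)
    rw [mul_zero] at this
    exact this.eventually_lt_const (by positivity)
  obtain ⟨N, hN⟩ := eventually_atTop.1 (h1.and h2)
  refine ⟨N, fun n hn t ht => ?_⟩
  obtain ⟨hn1, hn2⟩ := hN n hn
  have hh : 0 < 1 / ((n : ℝ) + 1) := by positivity
  set h := 1 / ((n : ℝ) + 1)
  refine (abs_eulerPath_sub_le hc hh hσ ht.1 ω).trans ?_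
  have h3 := natFloor_div_mul_le hh ht.1
  have h4 := sub_natFloor_div_mul_le hh t
  have h5 := hδW t ht (⌊t / h⌋₊ * h) ⟨by positivity, h3.trans ht.2⟩ (by
    rw [Real.dist_eq, abs_of_nonneg (sub_nonneg.2 h3)]; linarith)
  rw [Real.dist_eq] at h5
  have h6 : σ * |W t ω - W (⌊t / h⌋₊ * h) ω| ≤ (σ + 1) * (ε / (2 * (σ + 1))) :=
    mul_le_mul (by linarith) h5.le (abs_nonneg _) (by positivity)
  have h7 : (σ + 1) * (ε / (2 * (σ + 1))) = ε / 2 := by field_simp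
  linarith

end Euler


/-! ### Convergence of the Euler schemes and identification of the limit -/

section

variable {Ω : Type*} {mΩ : MeasurableSpace Ω} {P : Measure Ω} [IsProbabilityMeasure P]
  {W : ℝ → Ω → ℝ} {b₀ : ℝ → ℝ → ℝ} {φ : ℝ → ℝ} {σ x₀ C L T : ℝ}

/-- The pathwise stability bound holds almost surely for all pairs of schemes, with a deterministic
part in `ρ n + ρ m` and a pathwise part tending to zero for each `ω`. Hence the whole sequence
converges, without extracting a subsequence. -/
theorem ae_exists_tendsto_eulerPath (hc : IsCoefficientPair b₀ φ C L)
    (hW : IsGaussianPath P T W) (hT : 0 ≤ T) (hσ : 0 ≤ σ) :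
    ∀ᵐ ω ∂P, ∀ t ∈ Icc 0 T, ∃ x, Tendsto
      (fun n : ℕ => eulerPath P W b₀ φ σ x₀ (1 / ((n : ℝ) + 1)) t ω) atTop (𝓝 x) := by
  have hC := hc.bound_nonneg
  have hL := hc.lip_nonneg
  have hstep : ∀ n : ℕ, (0 : ℝ) < 1 / ((n : ℝ) + 1) := fun n => by positivity
  set ρ : ℕ → ℝ := fun n => 2 * C * (1 / ((n : ℝ) + 1)) + σ * √(1 / ((n : ℝ) + 1)) with hρ
  have hρ0 : Tendsto ρ atTop (𝓝 0) := by
    have h1 := tendsto_one_div_add_atTop_nhds_zero_nat (𝕜 := ℝ)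
    simpa [hρ] using (h1.const_mul (2 * C)).add (h1.sqrt.const_mul σ)
  have happ : ∀ n : ℕ, IsApproxSolution P W b₀ φ σ x₀ T (ρ n)
      (eulerPath P W b₀ φ σ x₀ (1 / ((n : ℝ) + 1)))
      (fun s => eulerNode P W b₀ φ σ x₀ (1 / ((n : ℝ) + 1)) ⌊s / (1 / ((n : ℝ) + 1))⌋₊) :=
    fun n => isApproxSolution_eulerPath hc hW (hstep n) hσ
  have hpath := ae_all_iff.2 fun n => ae_all_iff.2 fun m =>
    (happ n).sq_sub_le_of_path (happ m) hc ((happ n).integral_sub_sq_le (happ m) hc)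
  filter_upwards [hpath] with ω hω t ht
  refine cauchySeq_tendsto_of_complete (Metric.cauchySeq_iff.2 fun ε hε => ?_)
  set K := 2 * C + 4 * C * T * L
  have hK : 0 ≤ K := by positivity
  -- The stability bound is `c₁ * δ + c₂ * (ρ n + ρ m)`; `c₂` also absorbs the mean square bound put
  -- in place of `V`.
  set c₁ := 2 * K * T * Real.exp (2 * (3 / 2 * L) * T) with hc₁
  set c₂ := 2 * (K + L / 2 * (4 * K * T * Real.exp (4 * L * T))) * T
    * Real.exp (2 * (3 / 2 * L) * T) with hc₂
  have hc₁0 : 0 ≤ c₁ := by positivity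
  have hc₂0 : 0 ≤ c₂ := by positivity
  obtain ⟨η, hη, hηε⟩ : ∃ η : ℝ, 0 < η ∧ (c₁ + c₂) * (2 * η) < ε ^ 2 := by
    refine ⟨ε ^ 2 / (4 * (c₁ + c₂ + 1)), by positivity, ?_⟩
    have h1 : (c₁ + c₂) * (2 * (ε ^ 2 / (4 * (c₁ + c₂ + 1))))
        = ε ^ 2 * ((c₁ + c₂) / (2 * (c₁ + c₂ + 1))) := by field_simp; ring
    rw [h1]
    refine mul_lt_of_lt_one_right (by positivity) ((div_lt_one (by positivity)).2 (by linarith))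
  obtain ⟨N₁, hN₁⟩ := exists_forall_abs_eulerPath_sub_le (x₀ := x₀) hc hW hσ ω hη
  obtain ⟨N₂, hN₂⟩ := eventually_atTop.1 (hρ0.eventually_lt_const hη)
  refine ⟨max N₁ N₂, fun n hn m hm => ?_⟩
  have hn1 := hN₁ n (le_of_max_le_left hn)
  have hm1 := hN₁ m (le_of_max_le_left hm)
  have hn2 := hN₂ n (le_of_max_le_right hn)
  have hm2 := hN₂ m (le_of_max_le_right hm)
  have key := hω n m (2 * η) (fun s hs => by linarith [hn1 s hs, hm1 s hs]) t ht
  rw [Real.dist_eq]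
  refine abs_lt_of_sq_lt_sq ?_ hε.le
  refine key.trans_lt (lt_of_le_of_lt ?_ hηε)
  calc _ = c₁ * (2 * η) + c₂ * (ρ n + ρ m) := by rw [hc₁, hc₂]; ring
    _ ≤ c₁ * (2 * η) + c₂ * (2 * η) := by
        gcongr
        linarith
    _ = _ := by ring

theorem tendsto_integral_interaction (hc : IsCoefficientPair b₀ φ C L) {Y : ℕ → Ω → ℝ}
    {Z : Ω → ℝ} (hY : ∀ n, Measurable (Y n))
    (hYZ : ∀ᵐ ω ∂P, Tendsto (fun n => Y n ω) atTop (𝓝 (Z ω))) {y : ℕ → ℝ} {z : ℝ}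
    (hyz : Tendsto y atTop (𝓝 z)) :
    Tendsto (fun n => ∫ ω, b₀ (y n) (Y n ω) ∂P) atTop (𝓝 (∫ ω, b₀ z (Z ω) ∂P)) := by
  apply tendsto_integral_of_dominated_convergence (fun _ => C)
  · exact fun n => (hc.integrable_interaction (hY n) (y n)).aestronglyMeasurable
  · exact integrable_const _
  · exact fun n => ae_of_all _ fun ω => hc.abs_interaction_le _ _
  · filter_upwards [hYZ] with ω h
    exact (hc.continuous_uncurry.tendsto (z, Z ω)).comp (hyz.prodMk_nhds h)

/-- A pointwise limit of the Euler schemes solves the McKean–Vlasov equation. -/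
theorem ae_equation_of_tendsto_eulerPath (hc : IsCoefficientPair b₀ φ C L)
    (hW : IsGaussianPath P T W) (hσ : 0 < σ) {X : ℝ → Ω → ℝ}
    (hX : ∀ᵐ ω ∂P, ∀ t ∈ Icc 0 T, Tendsto
      (fun n : ℕ => eulerPath P W b₀ φ σ x₀ (1 / ((n : ℝ) + 1)) t ω) atTop (𝓝 (X t ω))) :
    ∀ᵐ ω ∂P,
      (∀ t ∈ Icc 0 T,
        X t ω = x₀ + (∫ s in (0 : ℝ)..t, lawDrift P b₀ φ (X s) (X s ω)) + σ * W t ω) ∧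
      ∀ s ∈ Icc 0 T, ∀ t ∈ Icc 0 T,
        |(X t ω - σ * W t ω) - (X s ω - σ * W s ω)| ≤ 2 * C * |t - s| := by
  have hstep : ∀ n : ℕ, (0 : ℝ) < 1 / ((n : ℝ) + 1) := fun n => by positivity
  have hfrozen : ∀ᵐ ω ∂P, ∀ t ∈ Icc 0 T, Tendsto (fun n : ℕ => eulerNode P W b₀ φ σ x₀
      (1 / ((n : ℝ) + 1)) ⌊t / (1 / ((n : ℝ) + 1))⌋₊ ω) atTop (𝓝 (X t ω)) := by
    filter_upwards [hX] with ω h t ht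
    have hdiff : Tendsto (fun n : ℕ => eulerPath P W b₀ φ σ x₀ (1 / ((n : ℝ) + 1)) t ω
        - eulerNode P W b₀ φ σ x₀ (1 / ((n : ℝ) + 1)) ⌊t / (1 / ((n : ℝ) + 1))⌋₊ ω)
        atTop (𝓝 0) := by
      rw [Metric.tendsto_atTop]
      intro ε hε
      obtain ⟨N, hN⟩ := exists_forall_abs_eulerPath_sub_le (x₀ := x₀) hc hW hσ.le ω (half_pos hε)
      refine ⟨N, fun n hn => ?_⟩
      rw [Real.dist_eq, sub_zero]
      linarith [hN n hn t ht]
    simpa using (h t ht).sub hdiff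
  filter_upwards [hX, hfrozen, hW.ae_forall_volume_level_eq_zero hσ] with ω h hf hocc
  have hYm : ∀ n : ℕ, Measurable (Function.uncurry fun (s : ℝ) ω => eulerNode P W b₀ φ σ x₀
      (1 / ((n : ℝ) + 1)) ⌊s / (1 / ((n : ℝ) + 1))⌋₊ ω) := fun n =>
    measurable_uncurry_eulerNode hc hW.measurable_coord
  -- The drift parts of all schemes are Lipschitz with the same constant `2 * C`, which survives in
  -- the limit. So the level-set result applies to `X` before any equation is known for it.
  have hlip : ∀ s ∈ Icc 0 T, ∀ t ∈ Icc 0 T,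
      |(X t ω - σ * W t ω) - (X s ω - σ * W s ω)| ≤ 2 * C * |t - s| := by
    intro s hs t ht
    refine le_of_tendsto (((h t ht).sub_const (σ * W t ω)).sub
      ((h s hs).sub_const (σ * W s ω))).abs (Eventually.of_forall fun n => ?_)
    have hint := hc.intervalIntegrable_lawDrift (P := P) (hYm n) ω
    have h1 := intervalIntegral.integral_interval_sub_left (hint 0 t) (hint 0 s)
    rw [eulerPath_eq hc hW.measurable_coord (hstep n) ht.1,
      eulerPath_eq hc hW.measurable_coord (hstep n) hs.1]
    have h2 := intervalIntegral.norm_integral_le_of_norm_le_const (a := s) (b := t) (C := 2 * C)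
      (f := fun r => lawDrift P b₀ φ
        (eulerNode P W b₀ φ σ x₀ (1 / ((n : ℝ) + 1)) ⌊r / (1 / ((n : ℝ) + 1))⌋₊)
        (eulerNode P W b₀ φ σ x₀ (1 / ((n : ℝ) + 1)) ⌊r / (1 / ((n : ℝ) + 1))⌋₊ ω))
      fun r _ => hc.abs_lawDrift_le _ _
    rw [← h1, Real.norm_eq_abs] at h2
    refine le_trans (le_of_eq ?_) h2
    congr 1
    ring
  refine ⟨fun t ht => ?_, hlip⟩
  have hcont : ContinuousOn (fun s => X s ω - σ * W s ω) (Icc 0 T) := by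
    have : LipschitzOnWith (2 * C).toNNReal (fun s => X s ω - σ * W s ω) (Icc 0 T) := by
      refine LipschitzOnWith.of_dist_le_mul fun s hs r hr => ?_
      rw [Real.coe_toNNReal _ (mul_nonneg zero_le_two hc.bound_nonneg), Real.dist_eq, Real.dist_eq]
      exact hlip r hr s hs
    exact this.continuousOn
  -- A countable union of null sets of times: for almost every time the limit sits at a continuity
  -- point of `φ`.
  have hdisc : volume (⋃ a ∈ {a | ¬ContinuousAt φ a}, {s | s ∈ Icc 0 T ∧ X s ω = a}) = 0 := by
    refine (measure_biUnion_null_iff hc.antitone_control.countable_not_continuousAt).2 fun a _ => ?_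
    simpa using hocc _ _ hcont hlip a
  have hlim : Tendsto (fun n : ℕ => ∫ s in (0 : ℝ)..t, lawDrift P b₀ φ
      (eulerNode P W b₀ φ σ x₀ (1 / ((n : ℝ) + 1)) ⌊s / (1 / ((n : ℝ) + 1))⌋₊)
      (eulerNode P W b₀ φ σ x₀ (1 / ((n : ℝ) + 1)) ⌊s / (1 / ((n : ℝ) + 1))⌋₊ ω)) atTop
      (𝓝 (∫ s in (0 : ℝ)..t, lawDrift P b₀ φ (X s) (X s ω))) := by
    apply intervalIntegral.tendsto_integral_filter_of_dominated_convergence (fun _ => 2 * C)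
    · exact Eventually.of_forall fun n =>
        ((hc.measurable_lawDrift_uncurry (P := P) (hYm n)).comp
          measurable_prodMk_right).aestronglyMeasurable
    · exact Eventually.of_forall fun n => ae_of_all _ fun s _ => hc.abs_lawDrift_le _ _
    · simp
    · filter_upwards [measure_eq_zero_iff_ae_notMem.1 hdisc] with s hs hst
      rw [uIoc_of_le ht.1] at hst
      have hsT : s ∈ Icc 0 T := ⟨hst.1.le, hst.2.trans ht.2⟩
      have hφ : ContinuousAt φ (X s ω) := by
        by_contra hn
        exact hs (mem_biUnion (x := X s ω) hn ⟨hsT, rfl⟩)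
      refine (tendsto_integral_interaction hc (fun n => (hYm n).comp measurable_prodMk_left) ?_
        (hf s hsT)).add (hφ.tendsto.comp (hf s hsT))
      filter_upwards [hfrozen] with ω' h' using h' s hsT
  refine tendsto_nhds_unique (h t ht) ?_
  refine Tendsto.congr (fun n => (eulerPath_eq hc hW.measurable_coord (hstep n) ht.1 ω).symm) ?_
  exact (hlim.const_add x₀).add_const (σ * W t ω)

end

/-! ### Uniqueness, regularity of the flow, and existence on `[0, T]` -/

section

theorem setIntegral_Iic_comap_volume {T : ℝ} (hT : 0 ≤ T) (f : Icc (0 : ℝ) T → ℝ)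
    (t : Icc (0 : ℝ) T) :
    ∫ s in Iic t, f s ∂(Measure.comap (fun s : Icc (0 : ℝ) T => (s : ℝ)) volume)
      = ∫ s in (0 : ℝ)..t, f (projIcc 0 T hT s) := by
  have hemb := MeasurableEmbedding.subtype_coe (measurableSet_Icc (a := (0 : ℝ)) (b := T))
  have h1 := hemb.setIntegral_map (μ := Measure.comap (fun s : Icc (0 : ℝ) T => (s : ℝ)) volume)
    (fun s => f (projIcc 0 T hT s)) (Iic (t : ℝ))
  have h2 : (fun s : Icc (0 : ℝ) T => (s : ℝ)) ⁻¹' Iic (t : ℝ) = Iic t := rfl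
  simp only [projIcc_val] at h1
  rw [h2] at h1
  rw [← h1, hemb.map_comap, Subtype.range_coe, Measure.restrict_restrict measurableSet_Iic,
    intervalIntegral.integral_of_le t.2.1, ← integral_Icc_eq_integral_Ioc]
  congr 2
  ext s
  simp only [mem_inter_iff, mem_Iic, mem_Icc]
  exact ⟨fun h => ⟨h.2.1, h.1⟩, fun h => ⟨h.2, h.1, h.2.trans t.2.2⟩⟩

variable {Ω : Type*} {mΩ : MeasurableSpace Ω} {P : Measure Ω}
  {b₀ : ℝ → ℝ → ℝ} {φ : ℝ → ℝ} {σ x₀ C L T : ℝ}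

theorem meanDrift_add_eq_lawDrift (hc : IsCoefficientPair b₀ φ C L) {Y : Ω → ℝ}
    (hY : Measurable Y) {m : ProbabilityMeasure ℝ} (hm : (m : Measure ℝ) = P.map Y) (x : ℝ) :
    meanDrift b₀ x m + φ x = lawDrift P b₀ φ Y x := by
  rw [meanDrift, lawDrift, hm, integral_map hY.aemeasurable]
  have : Continuous fun y => Function.uncurry b₀ (x, y) :=
    hc.continuous_uncurry.comp (by fun_prop)
  exact this.aestronglyMeasurable

theorem IsBrownianMotion.exists_isGaussianPath (hT : 0 ≤ T)
    {𝓕 : Filtration (Icc (0 : ℝ) T) mΩ} {W : Icc (0 : ℝ) T → Ω → ℝ}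
    (hW : IsBrownianMotion 𝓕 P W) :
    ∃ W' : ℝ → Ω → ℝ, IsGaussianPath P T W' ∧
      ∀ᵐ ω ∂P, ∀ t, W' t ω = W (projIcc 0 T hT t) ω := by
  obtain ⟨V, hVc, hVm, hV⟩ := exists_continuous_modification
    (fun t => (hW.adapted t).mono (𝓕.le t) le_rfl) hW.continuous_paths
  refine ⟨fun t => V (projIcc 0 T hT t), ⟨fun ω => (hVc ω).comp continuous_projIcc,
    fun t => hVm _, ?_⟩, ?_⟩
  · intro s hs t ht hst
    have h1 := hW.gaussian_increments ⟨s, hs⟩ ⟨t, ht⟩ hst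
    rw [← h1, projIcc_of_mem hT hs, projIcc_of_mem hT ht]
    apply Measure.map_congr
    filter_upwards [hV] with ω h
    rw [h, h]
  · filter_upwards [hV] with ω h t using h _

variable [IsProbabilityMeasure P]

/-- A solution of the McKean–Vlasov equation, up to modification and extension to the real
line. -/
theorem IsSolution.exists_isApproxSolution (hT : 0 ≤ T) (hc : IsCoefficientPair b₀ φ C L)
    {𝓕 : Filtration (Icc (0 : ℝ) T) mΩ} {W : Icc (0 : ℝ) T → Ω → ℝ} {W' : ℝ → Ω → ℝ}
    (hWW' : ∀ᵐ ω ∂P, ∀ t, W' t ω = W (projIcc 0 T hT t) ω)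
    {X : Icc (0 : ℝ) T → Ω → ℝ} {μ : Icc (0 : ℝ) T → ProbabilityMeasure ℝ}
    (hX : IsSolution 𝓕 P W b₀ φ σ x₀ X μ) :
    ∃ X' : ℝ → Ω → ℝ, IsApproxSolution P W' b₀ φ σ x₀ T 0 X' X' ∧
      ∀ᵐ ω ∂P, ∀ t : Icc (0 : ℝ) T, X' t ω = X t ω := by
  have hXm : ∀ t, Measurable (X t) := fun t => (hX.adapted t).mono (𝓕.le t) le_rfl
  obtain ⟨V, hVc, hVm, hV⟩ := exists_continuous_modification hXm hX.continuous_paths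
  have hVu : Measurable (Function.uncurry fun t => V (projIcc 0 T hT t)) :=
    measurable_uncurry_of_continuous_of_measurable
      (fun ω => (hVc ω).comp continuous_projIcc) fun t => hVm _
  refine ⟨fun t => V (projIcc 0 T hT t), ⟨hVu, hVu, ?_, ?_, ?_⟩, ?_⟩
  · filter_upwards [hX.equation, hV, hWW'] with ω h hv hw t ht
    have h1 := h ⟨t, ht⟩
    rw [setIntegral_Iic_comap_volume hT] at h1
    rw [hv, hw, projIcc_of_mem hT ht, h1]
    congr 2
    apply intervalIntegral.integral_congr
    intro s _
    have h2 : X (projIcc 0 T hT s) =ᵐ[P] V (projIcc 0 T hT s) := by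
      filter_upwards [hV] with ω h using (h _).symm
    simp only
    rw [meanDrift_add_eq_lawDrift hc (hXm _) (hX.law _), hv, lawDrift_congr_ae h2]
  · intro t _
    simp
  · intro t _
    simp
  · filter_upwards [hV] with ω h t
    rw [projIcc_val, h]

/-- With zero errors the mean square distance vanishes, so `V = 0` and `δ = 0` are admissible in the
pathwise bound. -/
theorem IsApproxSolution.ae_eq_of_exact {W : ℝ → Ω → ℝ} {X X' : ℝ → Ω → ℝ}
    (hc : IsCoefficientPair b₀ φ C L)
    (hX : IsApproxSolution P W b₀ φ σ x₀ T 0 X X)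
    (hX' : IsApproxSolution P W b₀ φ σ x₀ T 0 X' X') :
    ∀ᵐ ω ∂P, ∀ t ∈ Icc 0 T, X t ω = X' t ω := by
  have h := hX.sq_sub_le_of_path hX' hc (V := 0)
    fun t ht => by simpa using hX.integral_sub_sq_le hX' hc t ht
  filter_upwards [h] with ω hω t ht
  have h1 := hω 0 (fun t _ => by simp) t ht
  have h2 : (X t ω - X' t ω) ^ 2 = 0 := le_antisymm (by simpa using h1) (sq_nonneg _)
  exact sub_eq_zero.1 (pow_eq_zero_iff two_ne_zero |>.1 h2)

theorem IsSolution.unique (hT : 0 ≤ T) (hc : IsCoefficientPair b₀ φ C L)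
    {𝓕 : Filtration (Icc (0 : ℝ) T) mΩ} {W : Icc (0 : ℝ) T → Ω → ℝ}
    (hW : IsBrownianMotion 𝓕 P W)
    {X X' : Icc (0 : ℝ) T → Ω → ℝ} {μ μ' : Icc (0 : ℝ) T → ProbabilityMeasure ℝ}
    (hX : IsSolution 𝓕 P W b₀ φ σ x₀ X μ) (hX' : IsSolution 𝓕 P W b₀ φ σ x₀ X' μ') :
    (∀ᵐ ω ∂P, ∀ t, X' t ω = X t ω) ∧ μ' = μ := by
  obtain ⟨V, _, hV⟩ := hW.exists_isGaussianPath hT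
  obtain ⟨Z, hZ, hZX⟩ := hX.exists_isApproxSolution hT hc hV
  obtain ⟨Z', hZ', hZX'⟩ := hX'.exists_isApproxSolution hT hc hV
  have heq : ∀ᵐ ω ∂P, ∀ t, X' t ω = X t ω := by
    filter_upwards [hZX, hZX', hZ.ae_eq_of_exact hc hZ'] with ω h h' hzz t
    rw [← h, ← h', hzz t t.2]
  refine ⟨heq, ?_⟩
  funext t
  apply Subtype.ext
  change (μ' t : Measure ℝ) = (μ t : Measure ℝ)
  rw [hX'.law, hX.law]
  apply Measure.map_congr
  filter_upwards [heq] with ω h using h t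

/-- The measure is the image of `P` under the path map of a continuous modification, which has the
same time marginals. -/
theorem exists_pathMeasure {X : Icc (0 : ℝ) T → Ω → ℝ}
    (hm : ∀ t, Measurable (X t)) (hcont : ∀ᵐ ω ∂P, Continuous fun t => X t ω) :
    ∃ Q : @Measure C(Icc (0 : ℝ) T, ℝ) (pathSigmaAlgebra T),
      @IsProbabilityMeasure _ (pathSigmaAlgebra T) Q ∧
      ∀ t, @Measure.map _ _ (pathSigmaAlgebra T) _ (fun w => w t) Q = P.map (X t) := by
  obtain ⟨V, hVc, hVm, hV⟩ := exists_continuous_modification hm hcont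
  set F : Ω → C(Icc (0 : ℝ) T, ℝ) := fun ω => ⟨fun t => V t ω, hVc ω⟩ with hF
  let _ : MeasurableSpace C(Icc (0 : ℝ) T, ℝ) := pathSigmaAlgebra T
  have hFm : Measurable F := measurable_comap_iff.2 (measurable_pi_iff.2 hVm)
  have hev : ∀ t, Measurable fun w : C(Icc (0 : ℝ) T, ℝ) => w t := fun t =>
    (measurable_pi_apply t).comp (comap_measurable _)
  refine ⟨P.map F, Measure.isProbabilityMeasure_map hFm.aemeasurable, fun t => ?_⟩
  rw [Measure.map_map (hev t) hFm]
  apply Measure.map_congr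
  filter_upwards [hV] with ω h using h t

theorem abs_integral_comp_sub_le {Y Y' : Ω → ℝ} (hY : Measurable Y) (hY' : Measurable Y')
    {ψ : ℝ → ℝ} {M B : ℝ} {K : NNReal} (hψ : ∀ y, |ψ y| ≤ M) (hK : LipschitzWith K ψ)
    {Z : Ω → ℝ} (hZ : Integrable Z P) (hZB : ∫ ω, Z ω ∂P ≤ B)
    (hYY' : ∀ᵐ ω ∂P, |Y ω - Y' ω| ≤ Z ω) :
    |(∫ ω, ψ (Y ω) ∂P) - ∫ ω, ψ (Y' ω) ∂P| ≤ K * B := by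
  have hi : ∀ {Y : Ω → ℝ}, Measurable Y → Integrable (fun ω => ψ (Y ω)) P := fun hY =>
    Integrable.of_bound (hK.continuous.measurable.comp hY).aestronglyMeasurable M
      (ae_of_all _ fun ω => hψ _)
  rw [← integral_sub (hi hY) (hi hY')]
  refine abs_integral_le_integral_abs.trans ?_
  calc ∫ ω, |ψ (Y ω) - ψ (Y' ω)| ∂P ≤ ∫ ω, K * Z ω ∂P := by
        refine integral_mono_ae ((hi hY).sub (hi hY')).abs (hZ.const_mul _) ?_
        filter_upwards [hYY'] with ω h
        have := hK.dist_le_mul (Y ω) (Y' ω)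
        rw [Real.dist_eq, Real.dist_eq] at this
        exact this.trans (mul_le_mul_of_nonneg_left h K.2)
    _ ≤ K * B := by
        rw [integral_const_mul]
        exact mul_le_mul_of_nonneg_left hZB K.2

/-- The flow of laws of a process with Lipschitz drift and additive Brownian noise belongs to the
class `M_[0,T]`, with Hölder exponent `1 / 2`. -/
theorem mem_flowClass (hσ : 0 ≤ σ) {W : ℝ → Ω → ℝ} (hW : IsGaussianPath P T W)
    {X : Icc (0 : ℝ) T → Ω → ℝ} (hm : ∀ t, Measurable (X t))
    (hcont : ∀ᵐ ω ∂P, Continuous fun t => X t ω)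
    {K : ℝ} (hK : 0 ≤ K) (hlip : ∀ᵐ ω ∂P, ∀ s t : Icc (0 : ℝ) T,
      |(X t ω - σ * W t ω) - (X s ω - σ * W s ω)| ≤ K * |(t : ℝ) - s|)
    {μ : Icc (0 : ℝ) T → ProbabilityMeasure ℝ} (hμ : ∀ t, (μ t : Measure ℝ) = P.map (X t)) :
    μ ∈ flowClass T := by
  refine ⟨?_, 1 / 2, by norm_num, by norm_num, ?_⟩
  · obtain ⟨Q, hQ, hQX⟩ := exists_pathMeasure hm hcont
    exact ⟨Q, hQ, fun t => (hQX t).trans (hμ t).symm⟩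
  rintro ψ ⟨M, hM⟩ ⟨k, hk⟩
  have hmap : ∀ t, ∫ y, ψ y ∂(μ t : Measure ℝ) = ∫ ω, ψ (X t ω) ∂P := fun t => by
    rw [hμ, integral_map (hm t).aemeasurable hk.continuous.aestronglyMeasurable]
  have key : ∀ s t : Icc (0 : ℝ) T, s ≤ t →
      |(∫ y, ψ y ∂(μ t : Measure ℝ)) - ∫ y, ψ y ∂(μ s : Measure ℝ)|
        ≤ k * (K * √T + σ) * |(t : ℝ) - (s : ℝ)| ^ (1 / 2 : ℝ) := by
    intro s t hst
    have hst' : (s : ℝ) ≤ t := hst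
    have hWi := hW.integrable_sub s.2 t.2 hst'
    rw [hmap, hmap, ← Real.sqrt_eq_rpow, abs_of_nonneg (sub_nonneg.2 hst'), mul_assoc]
    refine abs_integral_comp_sub_le (hm t) (hm s) hM hk
      (Z := fun ω => K * ((t : ℝ) - s) + σ * |W t ω - W s ω|)
      ((integrable_const _).add (hWi.abs.const_mul σ)) ?_ ?_
    · rw [integral_add (integrable_const _) (hWi.abs.const_mul σ), integral_const_mul σ]
      simp only [integral_const, probReal_univ, smul_eq_mul, one_mul]
      have h1 := mul_le_mul_of_nonneg_left (hW.integral_abs_sub_le s.2 t.2 hst') hσ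
      have h2 : √((t : ℝ) - s) ≤ √T := Real.sqrt_le_sqrt (by linarith [t.2.2, s.2.1])
      have h3 : (t : ℝ) - s = √((t : ℝ) - s) * √((t : ℝ) - s) :=
        (Real.mul_self_sqrt (sub_nonneg.2 hst')).symm
      -- On a bounded interval the Lipschitz contribution of the drift is also `1 / 2`-Hölder, at
      -- the price of `√T`.
      have h4 : K * ((t : ℝ) - s) ≤ K * (√T * √((t : ℝ) - s)) := by
        refine mul_le_mul_of_nonneg_left ?_ hK
        nth_rewrite 1 [h3]
        exact mul_le_mul_of_nonneg_right h2 (Real.sqrt_nonneg _)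
      linarith
    · filter_upwards [hlip] with ω h
      have h1 := h s t
      rw [abs_of_nonneg (sub_nonneg.2 hst')] at h1
      have h2 : X t ω - X s ω = ((X t ω - σ * W t ω) - (X s ω - σ * W s ω))
        + σ * (W t ω - W s ω) := by ring
      rw [h2]
      refine (abs_add_le _ _).trans (add_le_add h1 ?_)
      rw [abs_mul, abs_of_nonneg hσ]
  refine ⟨k * (K * √T + σ), fun t t' => ?_⟩
  rcases le_total t t' with h | h
  · rw [abs_sub_comm, abs_sub_comm (t : ℝ)]
    exact key t t' h
  · exact key t' t h

theorem exists_isSolution_mem_flowClass (hT : 0 ≤ T) (hσ : 0 < σ)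
    (hc : IsCoefficientPair b₀ φ C L)
    {𝓕 : Filtration (Icc (0 : ℝ) T) mΩ} {W : Icc (0 : ℝ) T → Ω → ℝ}
    (hW : IsBrownianMotion 𝓕 P W) :
    ∃ (X : Icc (0 : ℝ) T → Ω → ℝ) (μ : Icc (0 : ℝ) T → ProbabilityMeasure ℝ),
      IsSolution 𝓕 P W b₀ φ σ x₀ X μ ∧ μ ∈ flowClass T := by
  obtain ⟨V, hV, hVW⟩ := hW.exists_isGaussianPath hT
  set U : ℝ → Ω → ℝ := fun t => W (projIcc 0 T hT t) with hU
  -- The upper limit is defined for every `ω` and uses the original `W`, so `X` is adapted although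
  -- the filtration is not assumed complete. Almost surely it is the limit of the schemes driven by
  -- `V`.
  set X : Icc (0 : ℝ) T → Ω → ℝ := fun t ω => limsup
    (fun n : ℕ => eulerPath P U b₀ φ σ x₀ (1 / ((n : ℝ) + 1)) t ω) atTop with hX
  have hadapted : Adapted 𝓕 X := by
    intro t
    refine Measurable.limsup fun n => ?_
    refine measurable_eulerPath hc (by positivity) (𝓕.le t) t.2.1 fun s hs => ?_
    refine (hW.adapted _).mono (𝓕.mono ?_) le_rfl
    rw [projIcc_of_mem hT ⟨hs.1, hs.2.trans t.2.2⟩]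
    exact hs.2
  have hXm : ∀ t, Measurable (X t) := fun t => (hadapted t).mono (𝓕.le t) le_rfl
  have hlim : ∀ᵐ ω ∂P, ∀ t ∈ Icc 0 T, Tendsto
      (fun n : ℕ => eulerPath P V b₀ φ σ x₀ (1 / ((n : ℝ) + 1)) t ω) atTop
      (𝓝 (X (projIcc 0 T hT t) ω)) := by
    have hUV := ae_all_iff.2 fun n : ℕ => eulerPath_ae_eq (b₀ := b₀) (φ := φ) (σ := σ)
      (x₀ := x₀) (h := 1 / ((n : ℝ) + 1)) hVW
    filter_upwards [ae_exists_tendsto_eulerPath (x₀ := x₀) hc hV hT hσ.le, hUV]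
      with ω h huv t ht
    obtain ⟨x, hx⟩ := h t ht
    convert! hx
    rw [projIcc_of_mem hT ht, ← hx.limsup_eq]
    simp only [hX, huv, hU]
  have hsol := ae_equation_of_tendsto_eulerPath (X := fun t => X (projIcc 0 T hT t))
    hc hV hσ hlim
  have hlip : ∀ᵐ ω ∂P, ∀ s t : Icc (0 : ℝ) T,
      |(X t ω - σ * V t ω) - (X s ω - σ * V s ω)| ≤ 2 * C * |(t : ℝ) - s| := by
    filter_upwards [hsol] with ω h s t
    simpa using h.2 s s.2 t t.2
  have hcont : ∀ᵐ ω ∂P, Continuous fun t => X t ω := by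
    filter_upwards [hlip] with ω h
    have h1 : LipschitzWith (2 * C).toNNReal fun t : Icc (0 : ℝ) T => X t ω - σ * V t ω := by
      refine LipschitzWith.of_dist_le_mul fun s t => ?_
      rw [Real.coe_toNNReal _ (mul_nonneg zero_le_two hc.bound_nonneg)]
      exact h t s
    have h2 : Continuous fun t : Icc (0 : ℝ) T => σ * V t ω :=
      ((hV.continuous_path ω).comp continuous_subtype_val).const_mul σ
    exact (h1.continuous.add h2).congr fun t => by simp
  refine ⟨X, fun t => ⟨P.map (X t), Measure.isProbabilityMeasure_map (hXm t).aemeasurable⟩,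
    ⟨hadapted, hcont, fun t => rfl, ?_⟩, ?_⟩
  · filter_upwards [hsol, hVW] with ω h hv t
    have h1 := h.1 t t.2
    rw [setIntegral_Iic_comap_volume hT]
    rw [hv, projIcc_val] at h1
    rw [h1]
    congr 2
    apply intervalIntegral.integral_congr
    intro s _
    exact (meanDrift_add_eq_lawDrift hc (hXm _) rfl _).symm
  · exact mem_flowClass hσ.le hV hXm hcont (mul_nonneg zero_le_two hc.bound_nonneg) hlip
      fun t => rfl

end

end McKeanVlasov

theorem mainTheorem4 {Ω : Type*} {mΩ : MeasurableSpace Ω} (P : Measure Ω) [IsProbabilityMeasure P]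
    (T : ℝ) (hT : 0 < T) (𝓕 : Filtration (Set.Icc (0 : ℝ) T) mΩ)
    (W : Set.Icc (0 : ℝ) T → Ω → ℝ) (hW : McKeanVlasov.IsBrownianMotion 𝓕 P W)
    (σ : ℝ) (hσ : 0 < σ) (x₀ : ℝ)
    (b₀ : ℝ → ℝ → ℝ) (hb_bdd : ∃ C, ∀ x y, |b₀ x y| ≤ C)
    (hb_lip : ∃ L, ∀ x y x' y', |b₀ x y - b₀ x' y'| ≤ L * (|x - x'| + |y - y'|))
    (φ : ℝ → ℝ) (hφ_meas : Measurable φ) (hφ_bdd : ∃ C, ∀ x, |φ x| ≤ C)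
    (hφ_mono : ∀ x y, (x - y) * (φ x - φ y) ≤ 0) :
    ∃ (X : Set.Icc (0 : ℝ) T → Ω → ℝ) (μ : Set.Icc (0 : ℝ) T → ProbabilityMeasure ℝ),
      McKeanVlasov.IsSolution 𝓕 P W b₀ φ σ x₀ X μ ∧
      μ ∈ McKeanVlasov.flowClass T ∧
      ∀ (X' : Set.Icc (0 : ℝ) T → Ω → ℝ) (μ' : Set.Icc (0 : ℝ) T → ProbabilityMeasure ℝ),
        McKeanVlasov.IsSolution 𝓕 P W b₀ φ σ x₀ X' μ' →
          (∀ᵐ ω ∂P, ∀ t, X' t ω = X t ω) ∧ μ' = μ := by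
  obtain ⟨C₁, hC₁⟩ := hb_bdd
  obtain ⟨C₂, hC₂⟩ := hφ_bdd
  obtain ⟨L, hL⟩ := hb_lip
  -- One bound serves both coefficients; the given `L` has no prescribed sign, hence the maximum
  -- with 0.
  have hc : McKeanVlasov.IsCoefficientPair b₀ φ (max C₁ C₂) (max L 0) :=
    { bound_nonneg := ((abs_nonneg _).trans (hC₁ 0 0)).trans (le_max_left _ _)
      lip_nonneg := le_max_right _ _
      abs_interaction_le := fun x y => (hC₁ x y).trans (le_max_left _ _)
      interaction_lipschitz := fun x y x' y' => (hL x y x' y').trans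
        (mul_le_mul_of_nonneg_right (le_max_left _ _) (by positivity))
      measurable_control := hφ_meas
      abs_control_le := fun x => (hC₂ x).trans (le_max_right _ _)
      control_rational := hφ_mono }
  obtain ⟨X, μ, hX, hμ⟩ :=
    McKeanVlasov.exists_isSolution_mem_flowClass (x₀ := x₀) hT.le hσ hc hW
  exact ⟨X, μ, hX, hμ, fun X' μ' hX' => hX.unique hT.le hc hW hX'⟩
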